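/- Let $\mathbb{R}^{n+1}_1$ be Lorentz–Minkowski space with $\langle x,y\rangle_L=x_1y_1+\dots+x_ny_n-x_{n+1}y_{n+1}$, and let $\mathscr H^n(1)=\{\langle x,x\rangle_L=-1,\ x_{n+1}>0\}$ be hyperbolic space, with induced metric $\sigma$ and covariant derivative $D$. Let $2\le k\le n$ and $0\le l\le k-2$. There is a constant $m=m(n,k,l)>1$ such that the following holds. Let $M\subset\mathscr H^n(1)$ be a bounded domain, $\rho<1$, and let $u>0$ be $C^3$ in $M$ and $C^1$ up to the boundary, with $|Du|/u\le\rho$, so that the graph $\mathcal G=\{u(x)x : x\in M\}$ is spacelike. Put $v=\sqrt{1-u^{-2}|Du|^2}$ and $\mathcal W=1/v=(1-|D\ln u|^2)^{-1/2}$. Let $\nu$ be the future-directed timelike unit normal of $\mathcal G$, let $\lambda_1,\dots,\lambda_n$ be its principal curvatures, i.e. the eigenvalues of $h_{ij}=-\langle X_{ij},\nu\rangle_L$ with respect to $g_{ij}=\langle X_i,X_j\rangle_L$, where $X=u(x)x$, let $\sigma_j$ be the $j$-th elementary symmetric function of $\lambda_1,\dots,\lambda_n$ ($\sigma_0=1$),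 and let $\vartheta=-\langle X,\nu\rangle_L$. Assume that $u$ is an admissible solution of $$\frac{\sigma_k}{\sigma_l}=\psi(x,u,\vartheta)\ \text{ in } M,\qquad u=\varphi\ \text{ on }\partial M,$$ where admissible means $\sigma_j>0$ on $\mathcal G$ for $1\le j\le k$. Assume also that the function $\Psi(x)=\psi(x,u(x),\vartheta(x))$ on $M$ satisfies $\Psi\ge b>0$ and $|D\Psi|\le B$ (for instance $b=\inf_M\Psi$ and $B=\sup_M|D\Psi|$). Let $S_1>1$ and $S_2$ be such that $$\rho^2\le 1-\frac{m(S_1+1)}{S_1(S_1-1)},\qquad S_2>\max\Big\{\frac{B}{(k-l)\,b},\,S_1\Big\}.$$ Then $$\sup_{\overline M}\mathcal W\le\Big(\sup_{\partial M}\mathcal W\Big)\,e^{S_2\left(2\sup_{\partial M}|\varphi|+\operatorname{diam}M\right)},$$ where $\operatorname{diam}M$ is the diameter of the Riemannian manifold $(M,\sigma)$, assumed finite (if $M$ is convex, this is its diameter in $\mathscr H^n(1)$). Moreover $$\sup_{\overline M}\mathcal W\le\Big(\sup_{\partial M}\mathcal W\Big)\,e^{S_2\left(2\sup_{\partial M}|\ln\varphi|+\operatorname{diam}_{\mathscr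 H^n(1)}M\right)},$$ where $\operatorname{diam}_{\mathscr H^n(1)}M$ is the diameter of $M$ for the distance of $\mathscr H^n(1)$. Consequently $|Du|\le u\sqrt{1-K^{-2}}$ on $\overline M$, where $K$ is either of the two right-hand sides. -/

import Mathlib

open Set

noncomputable section

namespace HypGraph

/-- Lorentz-Minkowski space of dimension `n + 1`; the last coordinate is the time coordinate. -/
abbrev Mink (n : ℕ) : Type := EuclideanSpace ℝ (Fin n) × ℝ

/-- The Lorentzian product `x₁y₁ + ⋯ + xₙyₙ - xₙ₊₁yₙ₊₁`. -/
def lorentz {n : ℕ} (X Y : Mink n) : ℝ := (∑ i, X.1 i * Y.1 i) - X.2 * Y.2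

/-- The hyperbolic space: the upper sheet of the unit hyperboloid, with the subspace topology. -/
abbrev Hyp (n : ℕ) : Type := {X : Mink n // lorentz X X = -1 ∧ 0 < X.2}

/-- The inverse of the global chart `(x₁, …, xₙ, xₙ₊₁) ↦ (x₁, …, xₙ)` of the hyperbolic space,
as a map into Minkowski space. -/
def position {n : ℕ} (ξ : EuclideanSpace ℝ (Fin n)) : Mink n := (ξ, √(1 + ‖ξ‖ ^ 2))

theorem position_mem {n : ℕ} (ξ : EuclideanSpace ℝ (Fin n)) :
    lorentz (position ξ) (position ξ) = -1 ∧ 0 < (position ξ).2 := by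
  have h : (0 : ℝ) < 1 + ‖ξ‖ ^ 2 := by positivity
  refine ⟨?_, Real.sqrt_pos.2 h⟩
  simp only [lorentz, position]
  rw [Real.mul_self_sqrt h.le, EuclideanSpace.real_norm_sq_eq]
  simp only [pow_two]
  ring

/-- The inverse of the global chart, as a map into the hyperbolic space. -/
def point {n : ℕ} (ξ : EuclideanSpace ℝ (Fin n)) : Hyp n := ⟨position ξ, position_mem ξ⟩

/-- The global chart. -/
def coord {n : ℕ} (x : Hyp n) : EuclideanSpace ℝ (Fin n) := x.1.1

/-- The coordinate basis vector. -/
def basisVec {n : ℕ} (i : Fin n) : EuclideanSpace ℝ (Fin n) := EuclideanSpace.single i 1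

/-- The coordinate vector field `∂ᵢ` of the hyperbolic space, as a vector of Minkowski space. -/
def coordField {n : ℕ} (x : Hyp n) (i : Fin n) : Mink n :=
  fderiv ℝ position (coord x) (basisVec i)

/-- The hyperbolic metric `σᵢⱼ` induced from the Lorentzian product, in the global chart. -/
def hypMetric {n : ℕ} (x : Hyp n) : Matrix (Fin n) (Fin n) ℝ :=
  Matrix.of fun i j => lorentz (coordField x i) (coordField x j)

/-- The norm `√(σ^{ij} pᵢ pⱼ)` of a covector (given in the global chart) for the hyperbolic
metric.  For `p` the differential of a function this is the norm of its gradient. -/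
def covecNorm {n : ℕ} (x : Hyp n) (p : EuclideanSpace ℝ (Fin n) →L[ℝ] ℝ) : ℝ :=
  √(∑ i, ∑ j, (hypMetric x)⁻¹ i j * p (basisVec i) * p (basisVec j))

/-- The gradient `σ^{ij} pᵢ ∂ⱼ` dual to a covector, as a vector of Minkowski space. -/
def gradVec {n : ℕ} (x : Hyp n) (p : EuclideanSpace ℝ (Fin n) →L[ℝ] ℝ) : Mink n :=
  ∑ i, ∑ j, ((hypMetric x)⁻¹ i j * p (basisVec i)) • coordField x j

/-- Hyperbolic distance: `cosh d(x, y) = -⟨x, y⟩`. -/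
def hypDist {n : ℕ} (x y : Hyp n) : ℝ := Real.arcosh (-lorentz x.1 y.1)

/-- Boundedness for the hyperbolic distance. -/
def HypBounded {n : ℕ} (M : Set (Hyp n)) : Prop := BddAbove (image2 hypDist M M)

/-- The diameter of `M` for the distance of the surrounding hyperbolic space. -/
def hypDiam {n : ℕ} (M : Set (Hyp n)) : ℝ := sSup (image2 hypDist M M)

/-- `γ` restricts to a continuously differentiable curve `[0,1] → M` from `x` to `y`. -/
def IsCurveIn {n : ℕ} (M : Set (Hyp n)) (x y : Hyp n) (γ : ℝ → Mink n) : Prop :=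
  ContDiffOn ℝ 1 γ (Icc 0 1) ∧ γ 0 = x.1 ∧ γ 1 = y.1 ∧
    ∀ t ∈ Icc (0 : ℝ) 1, γ t ∈ Subtype.val '' M

/-- Length of a curve `[0,1] → M` for the hyperbolic metric. -/
def curveLength {n : ℕ} (γ : ℝ → Mink n) : ENNReal :=
  ∫⁻ t in Icc (0 : ℝ) 1, ENNReal.ofReal
    (√(lorentz (derivWithin γ (Icc 0 1) t) (derivWithin γ (Icc 0 1) t)))

/-- The diameter of the Riemannian manifold `M` (with the hyperbolic metric): the supremum over
pairs of points of the infimum of the lengths of curves in `M` joining them. -/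
def riemDiam {n : ℕ} (M : Set (Hyp n)) : ENNReal :=
  ⨆ x ∈ M, ⨆ y ∈ M, ⨅ (γ : ℝ → Mink n) (_ : IsCurveIn M x y γ), curveLength γ

/-- `u` is `C³` on `M` and `C¹` up to the boundary, and `du` is its differential (in the global
chart), extended continuously to the closure of `M`. -/
structure HasDifferential {n : ℕ} (M : Set (Hyp n)) (u : Hyp n → ℝ)
    (du : Hyp n → EuclideanSpace ℝ (Fin n) →L[ℝ] ℝ) : Prop where
  contDiffOn : ContDiffOn ℝ 3 (fun ξ => u (point ξ)) (point ⁻¹' M)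
  hasFDerivAt : ∀ x ∈ M, HasFDerivAt (fun ξ => u (point ξ)) (du x) (coord x)
  continuousOn : ContinuousOn u (closure M)
  continuousOn_differential : ContinuousOn du (closure M)

section Graph

variable {n : ℕ} (u : Hyp n → ℝ) (du : Hyp n → EuclideanSpace ℝ (Fin n) →L[ℝ] ℝ)

/-- `v = √(1 - u⁻² |Du|²)`. -/
def tilt (x : Hyp n) : ℝ := √(1 - (covecNorm x (du x) / u x) ^ 2)

/-- `𝒲 = 1 / v = (1 - |D ln u|²)^(-1/2)`. -/
def gradFun (x : Hyp n) : ℝ := 1 / tilt u du x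

/-- The future-directed timelike unit normal `ν = v⁻¹ (∂ᵣ + D ln u)` of the graph
`{u(x) x}`; here `∂ᵣ` at the point `u(x) x` is the vector `x`, and `D ln u = u⁻¹ Du` is taken
in the hyperbolic space (its vectors being vectors of Minkowski space). -/
def normal (x : Hyp n) : Mink n :=
  (1 / tilt u du x) • (x.1 + (1 / u x) • gradVec x (du x))

/-- `ϑ = -⟨X, ν⟩` with `X = u(x) x`. -/
def support (x : Hyp n) : ℝ := -lorentz (u x • x.1) (normal u du x)

/-- The parametrization `X = u(x) x` of the graph, in the global chart. -/
def graphMap (ξ : EuclideanSpace ℝ (Fin n)) : Mink n := u (point ξ) • position ξ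

/-- The metric `gᵢⱼ = ⟨Xᵢ, Xⱼ⟩` induced on the graph. -/
def graphMetric (x : Hyp n) : Matrix (Fin n) (Fin n) ℝ :=
  Matrix.of fun i j => lorentz (fderiv ℝ (graphMap u) (coord x) (basisVec i))
    (fderiv ℝ (graphMap u) (coord x) (basisVec j))

/-- The second fundamental form `hᵢⱼ = -⟨∂ⱼ Xᵢ, ν⟩` of the graph. -/
def secondForm (x : Hyp n) : Matrix (Fin n) (Fin n) ℝ :=
  Matrix.of fun i j =>
    -lorentz (fderiv ℝ (fun ξ => fderiv ℝ (graphMap u) ξ (basisVec i)) (coord x) (basisVec j))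
      (normal u du x)

/-- The principal curvatures: the eigenvalues, with multiplicity, of `hᵢⱼ` with respect to `gᵢⱼ`.
(They are all real since the graph is spacelike.) -/
def principalCurvatures (x : Hyp n) : Multiset ℝ :=
  ((graphMetric u x)⁻¹ * secondForm u du x).charpoly.roots

/-- The `j`-th Weingarten curvature `σⱼ(λ₁, …, λₙ)`; it is `1` for `j = 0`. -/
def weingarten (j : ℕ) (x : Hyp n) : ℝ := (principalCurvatures u du x).esymm j

/-- The graph of `u` over `M` is `k`-admissible: `(λ₁, …, λₙ) ∈ Γₖ` at every point. -/
def IsAdmissible (k : ℕ) (M : Set (Hyp n)) : Prop :=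
  ∀ x ∈ M, ∀ j, 1 ≤ j → j ≤ k → 0 < weingarten u du j x

/-- The right-hand side `ψ(x, u, ϑ)`, evaluated along the graph. -/
def rhs (ψ : Hyp n → ℝ → ℝ → ℝ) (x : Hyp n) : ℝ := ψ x (u x) (support u du x)

/-- The differential at `x`, in the global chart, of the function `x ↦ ψ(x, u(x), ϑ(x))`.
(Where the equation holds and `u` is `C³`, this function is continuously differentiable.) -/
def rhsDifferential (ψ : Hyp n → ℝ → ℝ → ℝ) (x : Hyp n) : EuclideanSpace ℝ (Fin n) →L[ℝ] ℝ :=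
  fderiv ℝ (fun ξ => rhs u du ψ (point ξ)) (coord x)

/-- `u > 0` solves the Dirichlet problem `σₖ/σₗ = ψ(x, u, ϑ)` in `M`, `u = φ` on `∂M`, and its
graph is `k`-admissible and spacelike with `|Du| / u ≤ ρ < 1`. -/
structure IsAdmissibleSolution (k l : ℕ) (M : Set (Hyp n)) (ψ : Hyp n → ℝ → ℝ → ℝ)
    (φ : Hyp n → ℝ) (ρ : ℝ) : Prop where
  differential : HasDifferential M u du
  pos : ∀ x ∈ closure M, 0 < u x
  rho_lt_one : ρ < 1
  spacelike : ∀ x ∈ M, covecNorm x (du x) / u x ≤ ρ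
  admissible : IsAdmissible u du k M
  equation : ∀ x ∈ M, weingarten u du k x / weingarten u du l x = rhs u du ψ x
  boundary : ∀ x ∈ frontier M, u x = φ x

/-- The supremum of `𝒲` over the boundary of `M`. -/
def boundarySup (M : Set (Hyp n)) : ℝ := sSup (gradFun u du '' frontier M)

/-- The estimate `𝒲 ≤ K` on the closure of `M`, and the bound `|Du| ≤ u √(1 - K⁻²)` that it
gives for the gradient of `u`. -/
def GradientBound (M : Set (Hyp n)) (K : ℝ) : Prop :=
  ∀ x ∈ closure M, gradFun u du x ≤ K ∧ covecNorm x (du x) ≤ u x * √(1 - 1 / K ^ 2)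

end Graph

end HypGraph

end

/-! Apply the maximum principle to ln 𝒲 + S ln u, with S = S₂. Because ϑ = u𝒲 and -⟨X, X⟩ = u², this
function equals ln ϑ + (S - 1) ln |X|. Suppose it has an interior local maximum where 𝒲 > 1. Split X
= X_*(z) + u𝒲ν and let Z_a be the components of z in a principal frame. The first-order condition
says that Z_a = 0 or uλ_a = -(S - 1)𝒲. Since z ≠ 0, some λ_{a₀} is very negative.

The second-order conditions in the principal directions are summed with the weights q_a = σ_l²
∂_a(σ_k/σ_l) ≥ 0. The symmetry of D³X (the Codazzi equation of a flat ambient space) turns the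
third-order terms into the derivative of σ_k/σ_l = Ψ along z, which B controls. Euler's relation
gives a positive multiple of (k - l)σ_kσ_l, which beats that derivative because B < S(k - l)b. The
remaining bad term -(S - 1)∑q_a is absorbed by the λ_{a₀}² term: in the Gårding cone a negative
curvature satisfies ∑q_a ≤ n(k + 1)q_{a₀} (`sum_quotDeriv_le_of_neg`). The contradiction
(`interior_max_algebra`, fed by `IsHypersurfaceAt.conditions_of_isLocalMax`) gives
`gradFun_le_one_of_isLocalMax`: 𝒲 = 1 at interior maxima.

Consequently 𝒲 is at most its boundary supremum times exp(S · osc ln u) (`gradientBound_of_osc`). As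
|D ln u| < 1, the oscillation is at most the intrinsic diameter. For the ambient diameter, the
geodesic through two points is prolonged beyond both until it leaves M, and the boundary values are
compared at the two exits (`log_sub_le_hypDiam`). -/

namespace HypGraph

/-! ### Real-rooted polynomials and Newton's inequality -/

open Polynomial in
/-- The derivative of a real-rooted polynomial is real-rooted. -/
theorem splits_derivative {p : ℝ[X]} (hp : p.Splits) : p.derivative.Splits := by
  rw [splits_iff_card_roots] at hp ⊢
  have h1 := card_roots_le_derivative p
  have h2 := natDegree_derivative p
  have h3 := card_roots' p.derivative
  omega

open Polynomial in
theorem splits_iterate_derivative {p : ℝ[X]} (hp : p.Splits) (m : ℕ) :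
    (derivative^[m] p).Splits := by
  induction m with
  | zero => exact hp
  | succ m ih => rw [Function.iterate_succ_apply']; exact splits_derivative ih

open Polynomial in
/-- Laguerre's inequality `p p'' ≤ p'²` for a real-rooted polynomial. -/
theorem laguerre {p : ℝ[X]} (hp : p.Splits) (x : ℝ) :
    p.eval x * p.derivative.derivative.eval x ≤ p.derivative.eval x ^ 2 := by
  obtain ⟨m, hm⟩ := splits_iff_exists_multiset.1 hp
  rw [hm]
  generalize p.leadingCoeff = a
  clear hm hp p
  induction m using Multiset.induction_on with
  | empty => simp
  | cons r m ih =>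
    rw [Multiset.map_cons, Multiset.prod_cons]
    set q := C a * (Multiset.map (fun a => X - C a) m).prod with hq
    have : C a * ((X - C r) * (Multiset.map (fun a => X - C a) m).prod) = (X - C r) * q := by
      rw [hq]; ring
    rw [this]
    simp only [derivative_mul, derivative_sub, derivative_X, derivative_C, sub_zero, one_mul,
      derivative_add, eval_add, eval_mul, eval_sub, eval_X, eval_C]
    -- For p = (X - r)q one has p'² - pp'' = (x - r)²(q'² - qq'') + q².
    nlinarith [mul_le_mul_of_nonneg_left ih (sq_nonneg (x - r)), sq_nonneg (q.eval x)]

-- Laguerre's inequality at 0 for the m-th derivative, whose first Taylor data are m! pₘ, (m+1)!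
-- pₘ₊₁, (m+2)! pₘ₊₂. The degree of p does not enter, so this is weaker than Newton's sharp
-- inequality, but it keeps the factor that is needed later.
open Polynomial in
theorem newton_coeff {p : ℝ[X]} (hp : p.Splits) (m : ℕ) :
    ((m : ℝ) + 2) * (p.coeff m * p.coeff (m + 2)) ≤ ((m : ℝ) + 1) * p.coeff (m + 1) ^ 2 := by
  have h := laguerre (splits_iterate_derivative hp m) 0
  rw [← Function.iterate_succ_apply' derivative, ← Function.iterate_succ_apply' derivative,
    ← coeff_zero_eq_eval_zero, ← coeff_zero_eq_eval_zero, ← coeff_zero_eq_eval_zero,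
    coeff_iterate_derivative, coeff_iterate_derivative, coeff_iterate_derivative] at h
  simp only [zero_add, Nat.succ_eq_add_one, Nat.descFactorial_self, nsmul_eq_mul,
    Nat.factorial_succ, Nat.cast_mul] at h
  push_cast at h
  have hm : (0 : ℝ) < (m.factorial : ℝ) := by positivity
  have h1 : 0 < (m.factorial : ℝ) ^ 2 * (m + 1) := by positivity
  refine le_of_mul_le_mul_left ?_ h1
  rw [show m + 1 + 1 = m + 2 from rfl] at h
  nlinarith [h]

/-! ### Elementary symmetric functions and the Gårding cone -/

section Esymm

variable {ι : Type*} (f : ι → ℝ)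

open Polynomial

/-- The generating polynomial `∏ (1 + fᵢ X)` of the elementary symmetric functions. -/
noncomputable def genPoly (s : Finset ι) : ℝ[X] := ∏ i ∈ s, (1 + C (f i) * X)

/-- The elementary symmetric functions of a finite family. -/
noncomputable def elem (s : Finset ι) (j : ℕ) : ℝ := (genPoly f s).coeff j

/-- The derivative of the `j`-th elementary symmetric function in the `a`-th variable. -/
noncomputable def elemDeriv [DecidableEq ι] (s : Finset ι) (j : ℕ) (a : ι) : ℝ :=
  (X * genPoly f (s.erase a)).coeff j

theorem splits_genPoly (s : Finset ι) : (genPoly f s).Splits := by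
  refine Splits.prod fun i _ => Splits.of_natDegree_le_one ?_
  compute_degree

theorem natDegree_genPoly_le (s : Finset ι) : (genPoly f s).natDegree ≤ s.card := by
  refine (natDegree_prod_le _ _).trans ?_
  refine (Finset.sum_le_card_nsmul _ _ 1 fun i _ => ?_).trans (by simp)
  compute_degree

theorem elem_eq_esymm (s : Finset ι) (j : ℕ) : elem f s j = (s.val.map f).esymm j := by
  rw [elem, genPoly, Finset.prod_one_add, Finset.esymm_map_val, finsetSum_coeff,
    Finset.powersetCard_eq_filter, Finset.sum_filter]
  refine Finset.sum_congr rfl fun t _ => ?_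
  rw [Finset.prod_mul_distrib, Finset.prod_const, ← map_prod, coeff_C_mul_X_pow]
  simp [eq_comm]

@[simp] theorem elem_zero (s : Finset ι) : elem f s 0 = 1 := by
  simp [elem, genPoly, coeff_zero_eq_eval_zero, eval_prod]

theorem newton_elem (s : Finset ι) (j : ℕ) :
    ((j : ℝ) + 2) * (elem f s j * elem f s (j + 2)) ≤ ((j : ℝ) + 1) * elem f s (j + 1) ^ 2 :=
  newton_coeff (splits_genPoly f s) j

/-- A quantitative Newton-Maclaurin inequality in the Gårding cone. -/
theorem newton_maclaurin {s : Finset ι} {k l : ℕ} (hlk : l + 1 ≤ k)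
    (h : ∀ j, j ≤ k → 0 < elem f s j) :
    ((k : ℝ) + 1) * (elem f s (k + 1) * elem f s l) ≤ k * (elem f s k * elem f s (l + 1)) ∨
      elem f s (k + 1) * elem f s l ≤ 0 := by
  by_cases hk : elem f s (k + 1) ≤ 0
  · exact Or.inr (mul_nonpos_of_nonpos_of_nonneg hk (h l (by omega)).le)
  push Not at hk
  left
  -- Newton's inequalities at consecutive indices are chained; j = l + 1 is Newton itself. The
  -- factors j + 1 and j are kept because their gap is what makes `quotDeriv_lower` quantitative.
  have key : ∀ d j, l + d + 1 = j → j ≤ k →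
      ((j : ℝ) + 1) * (elem f s (j + 1) * elem f s l) ≤ j * (elem f s j * elem f s (l + 1)) := by
    intro d
    induction d with
    | zero =>
      intro j hj hjk
      obtain rfl : j = l + 1 := by omega
      have := newton_elem f s l
      push_cast
      nlinarith
    | succ d ih =>
      intro j hj hjk
      obtain ⟨i, rfl⟩ : ∃ i, j = i + 1 := ⟨j - 1, by omega⟩
      have h1 := ih i (by omega) (by omega)
      have h2 := newton_elem f s i
      have p0 := h i (by omega)
      have p1 := h (i + 1) hjk
      have pl := h l (by omega)
      have pl1 := h (l + 1) (by omega)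
      have p2 : 0 < elem f s (i + 2) := by
        rcases eq_or_lt_of_le hjk with h | h'
        · subst h; exact hk
        · exact h _ (by omega)
      push_cast
      rw [show i + 1 + 1 = i + 2 from rfl]
      set A := elem f s i
      set Bq := elem f s (i + 1)
      set Cq := elem f s (i + 2)
      set p := elem f s l
      set q := elem f s (l + 1)
      have hi : (0 : ℝ) ≤ i := by positivity
      have h3 : Bq * p ≤ A * q := by
        have : (i : ℝ) * (A * q) ≤ (i + 1) * (A * q) := by nlinarith [mul_pos p0 pl1]
        nlinarith [mul_pos p0 pl1, mul_pos p1 pl]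
      have h4 : A * (((i : ℝ) + 2) * (Cq * p)) ≤ A * ((i + 1) * (Bq * q)) := by
        calc A * (((i : ℝ) + 2) * (Cq * p)) = (i + 2) * (A * Cq) * p := by ring
          _ ≤ ((i + 1) * Bq ^ 2) * p := by gcongr
          _ = (i + 1) * Bq * (Bq * p) := by ring
          _ ≤ (i + 1) * Bq * (A * q) := by gcongr
          _ = _ := by ring
      have := le_of_mul_le_mul_left h4 p0
      linarith
  exact key (k - l - 1) k (by omega) le_rfl

variable [DecidableEq ι]

theorem elemDeriv_zero (s : Finset ι) (a : ι) : elemDeriv f s 0 a = 0 := by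
  simp [elemDeriv]

theorem elemDeriv_succ (s : Finset ι) (j : ℕ) (a : ι) :
    elemDeriv f s (j + 1) a = elem f (s.erase a) j := by
  simp [elemDeriv, elem]

theorem genPoly_erase {s : Finset ι} {a : ι} (ha : a ∈ s) :
    genPoly f s = (1 + C (f a) * X) * genPoly f (s.erase a) := by
  exact (Finset.mul_prod_erase s _ ha).symm

theorem elem_eq_add {s : Finset ι} {a : ι} (ha : a ∈ s) (j : ℕ) :
    elem f s j = elem f (s.erase a) j + f a * elemDeriv f s j a := by
  rw [elem, genPoly_erase f ha, add_mul, one_mul, mul_assoc, coeff_add, coeff_C_mul]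
  rfl

/-- Euler's relation, read off as the coefficient of X^j in X · G', where G is the generating
polynomial and G' comes from the product rule. -/
theorem sum_mul_elemDeriv (s : Finset ι) (j : ℕ) :
    ∑ a ∈ s, f a * elemDeriv f s j a = j * elem f s j := by
  have h : X * derivative (genPoly f s) = ∑ a ∈ s, C (f a) * (X * genPoly f (s.erase a)) := by
    rw [genPoly, derivative_prod_finset, Finset.mul_sum]
    refine Finset.sum_congr rfl fun a _ => ?_
    simp only [genPoly, derivative_add, derivative_one, zero_add, derivative_C_mul, derivative_X]
    ring
  have h2 := congrArg (fun q => q.coeff j) h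
  simp only [finsetSum_coeff, coeff_C_mul] at h2
  rw [elem]
  refine h2.symm.trans ?_
  cases j with
  | zero => simp
  | succ j => rw [coeff_X_mul, coeff_derivative]; push_cast; ring

theorem sum_elemDeriv_succ (s : Finset ι) (j : ℕ) :
    ∑ a ∈ s, elemDeriv f s (j + 1) a = (s.card - j) * elem f s j := by
  have h : ∑ a ∈ s, elem f (s.erase a) j = ∑ a ∈ s, (elem f s j - f a * elemDeriv f s j a) :=
    Finset.sum_congr rfl fun a ha => by rw [elem_eq_add f ha]; ring
  simp only [elemDeriv_succ]
  rw [h, Finset.sum_sub_distrib, sum_mul_elemDeriv, Finset.sum_const, nsmul_eq_mul]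
  ring

/-- Removing one variable from a point of the Gårding cone `Γₖ` gives a point of `Γₖ₋₁`. -/
theorem elem_erase_pos {s : Finset ι} {k : ℕ} (h : ∀ j, j ≤ k → 0 < elem f s j) {a : ι}
    (ha : a ∈ s) : ∀ j, j + 1 ≤ k → 0 < elem f (s.erase a) j := by
  intro j
  induction j with
  | zero => simp
  | succ j ih =>
    intro hj
    have h0 := ih (by omega)
    have h1 := h (j + 1) (by omega)
    have h2 := h (j + 2) (by omega)
    rw [elem_eq_add f ha, elemDeriv_succ] at h1 h2
    have hN := newton_elem f (s.erase a) j
    set x := elem f (s.erase a) j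
    set y := elem f (s.erase a) (j + 1)
    set z := elem f (s.erase a) (j + 2)
    -- With y ≤ 0, positivity of y + f a · x forces f a > 0. Then z > -f a · y ≥ 0, so xz > y²,
    -- against Newton's inequality for the remaining variables.
    by_contra hy
    push Not at hy
    have hfa : 0 < f a := by
      by_contra hf
      push Not at hf
      nlinarith [mul_nonneg_of_nonpos_of_nonpos (neg_nonpos.2 h0.le) hf]
    have hz : 0 < z := by nlinarith
    have hxz : y ^ 2 < x * z := by nlinarith
    have hj0 : (0 : ℝ) ≤ j := by positivity
    nlinarith [mul_pos h0 hz]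

/-- The numerator of `∂ₐ (σₖ / σₗ)`. -/
noncomputable def quotDeriv (s : Finset ι) (k l : ℕ) (a : ι) : ℝ :=
  elemDeriv f s k a * elem f s l - elem f s k * elemDeriv f s l a

/-- Expanding both functions in the variable λ_a, the terms with λ_a cancel: q_a = σₖ₋₁σₗ - σₖσₗ₋₁,
all evaluated with λ_a removed. The remaining variables lie in Γₖ₋₁, so `newton_maclaurin` bounds a
positive subtracted product by (k - 1)/k times the first one. The factor k + 1 instead of k is
slack. -/
theorem quotDeriv_lower {s : Finset ι} {k l : ℕ} (hlk : l + 2 ≤ k)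
    (h : ∀ j, j ≤ k → 0 < elem f s j) {a : ι} (ha : a ∈ s) :
    elem f (s.erase a) (k - 1) * elem f (s.erase a) l ≤ (k + 1) * quotDeriv f s k l a := by
  have hp := elem_erase_pos f h ha
  obtain ⟨k, rfl⟩ : ∃ i, k = i + 1 := ⟨k - 1, by omega⟩
  have hk0 : (0 : ℝ) ≤ k := by positivity
  have e : quotDeriv f s (k + 1) l a = elem f (s.erase a) k * elem f (s.erase a) l -
      elem f (s.erase a) (k + 1) * elemDeriv f s l a := by
    rw [quotDeriv, elem_eq_add f ha, elem_eq_add f ha, elemDeriv_succ]; ring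
  rw [e, Nat.add_sub_cancel]
  have p1 := mul_pos (hp k le_rfl) (hp l (by omega))
  push_cast
  cases l with
  | zero =>
    rw [elemDeriv_zero]
    nlinarith
  | succ l =>
    rw [elemDeriv_succ]
    rcases newton_maclaurin f (s := s.erase a) (k := k) (l := l) (by omega)
      (fun j hj => hp j (by omega)) with h1 | h1
    · nlinarith
    · nlinarith

theorem quotDeriv_nonneg {s : Finset ι} {k l : ℕ} (hlk : l + 2 ≤ k)
    (h : ∀ j, j ≤ k → 0 < elem f s j) {a : ι} (ha : a ∈ s) : 0 ≤ quotDeriv f s k l a := by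
  have h1 := quotDeriv_lower f hlk h ha
  have hp := elem_erase_pos f h ha
  have p1 := mul_pos (hp (k - 1) (by omega)) (hp l (by omega))
  by_contra hq
  push Not at hq
  nlinarith [mul_pos_of_neg_of_neg hq (neg_lt_zero.2 (by positivity : (0 : ℝ) < k + 1))]

theorem sum_mul_quotDeriv (s : Finset ι) (k l : ℕ) :
    ∑ a ∈ s, f a * quotDeriv f s k l a = (k - l) * (elem f s k * elem f s l) := by
  have : ∀ a ∈ s, f a * quotDeriv f s k l a = f a * elemDeriv f s k a * elem f s l -
      f a * elemDeriv f s l a * elem f s k := fun a _ => by rw [quotDeriv]; ring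
  rw [Finset.sum_congr rfl this, Finset.sum_sub_distrib, ← Finset.sum_mul, ← Finset.sum_mul,
    sum_mul_elemDeriv, sum_mul_elemDeriv]
  ring

/-- A negative curvature carries a fixed proportion of the trace of the linearized operator. -/
theorem sum_quotDeriv_le_of_neg {s : Finset ι} {k l : ℕ} (hlk : l + 2 ≤ k)
    (h : ∀ j, j ≤ k → 0 < elem f s j) {a : ι} (ha : a ∈ s) (hneg : f a < 0) :
    ∑ i ∈ s, quotDeriv f s k l i ≤ s.card * ((k + 1) * quotDeriv f s k l a) := by
  have hp := elem_erase_pos f h ha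
  have h1 := quotDeriv_lower f hlk h ha
  -- The contribution of the derivatives of σ_l has a favourable sign and is dropped; those of σ_k
  -- sum to (n - k + 1)σₖ₋₁.
  have hsum : ∑ i ∈ s, quotDeriv f s k l i ≤ s.card * (elem f s (k - 1) * elem f s l) := by
    have : ∑ i ∈ s, quotDeriv f s k l i = (∑ i ∈ s, elemDeriv f s k i) * elem f s l -
        elem f s k * ∑ i ∈ s, elemDeriv f s l i := by
      simp only [quotDeriv]
      rw [Finset.sum_sub_distrib, Finset.sum_mul, Finset.mul_sum]
    have hl : 0 ≤ ∑ i ∈ s, elemDeriv f s l i := by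
      refine Finset.sum_nonneg fun i hi => ?_
      cases l with
      | zero => rw [elemDeriv_zero]
      | succ l => rw [elemDeriv_succ]; exact (elem_erase_pos f h hi l (by omega)).le
    have hkk : ∑ i ∈ s, elemDeriv f s k i ≤ s.card * elem f s (k - 1) := by
      obtain ⟨k, rfl⟩ : ∃ i, k = i + 1 := ⟨k - 1, by omega⟩
      rw [sum_elemDeriv_succ, Nat.add_sub_cancel]
      have := h k (by omega)
      have hk0 : (0 : ℝ) ≤ k := by positivity
      nlinarith
    rw [this]
    nlinarith [mul_nonneg (h k le_rfl).le hl, mul_le_mul_of_nonneg_right hkk (h l (by omega)).le]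
  -- Deleting a negative variable increases σ_j: the discarded term is λ_a times a positive number.
  have a1 : elem f s (k - 1) ≤ elem f (s.erase a) (k - 1) := by
    obtain ⟨k, rfl⟩ : ∃ i, k = i + 2 := ⟨k - 2, by omega⟩
    rw [show k + 2 - 1 = k + 1 from rfl, elem_eq_add f ha, elemDeriv_succ]
    nlinarith [hp k (by omega)]
  have a2 : elem f s l ≤ elem f (s.erase a) l := by
    rw [elem_eq_add f ha]
    cases l with
    | zero => rw [elemDeriv_zero]; simp
    | succ l => rw [elemDeriv_succ]; nlinarith [hp l (by omega)]
  have a3 : elem f s (k - 1) * elem f s l ≤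
      elem f (s.erase a) (k - 1) * elem f (s.erase a) l :=
    mul_le_mul a1 a2 (h l (by omega)).le (hp (k - 1) (by omega)).le
  calc _ ≤ _ := hsum
    _ ≤ _ := mul_le_mul_of_nonneg_left (a3.trans h1) (Nat.cast_nonneg _)

end Esymm

end HypGraph

/-! ### The algebraic contradiction at an interior maximum -/

namespace HypGraph

/-- After B < Sκb and bσ_l ≤ σ_k, dividing by (u/W)σ_l²κb leaves S·W√(W² - 1) against (S - 1)W² - 1.
The leading terms SW² agree, so the gap has to come from √(W² - 1) ≤ W - 1/(2W), which gains S/2;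
and S - 1 ≥ 4W² makes S/2 exceed W² + 1. -/
theorem gradient_term_lt {u W S b B κ sk sl : ℝ} (hu : 0 < u) (hW : 1 < W)
    (hb : 0 < b) (hB : 0 ≤ B) (hkl : 0 < κ) (hBS : B < S * (κ * b)) (hc4 : 4 * W ^ 2 ≤ S - 1)
    (hsl : 0 < sl) (hF : b * sl ≤ sk) :
    u / W * (sl ^ 2 * (B * (W * √(W ^ 2 - 1)))) <
      ((S - 1) * u * W - u / W) * (κ * (sk * sl)) := by
  have hW2 : 1 < W ^ 2 := by nlinarith
  set c := S - 1 with hc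
  have hcpos : 0 < c := by linarith
  have hsqrt : √(W ^ 2 - 1) ≤ W - 1 / (2 * W) := by
    rw [Real.sqrt_le_left]
    · have : (W - 1 / (2 * W)) ^ 2 = W ^ 2 - 1 + (1 / (2 * W)) ^ 2 := by field_simp; ring
      rw [this]; exact le_add_of_nonneg_right (sq_nonneg _)
    · rw [sub_nonneg, div_le_iff₀ (by positivity), show W * (2 * W) = 2 * W ^ 2 by ring]; linarith
  have hcW : 0 < c * u * W - u / W := by
    have : c * u * W - u / W = u / W * (c * W ^ 2 - 1) := by field_simp
    rw [this]
    exact mul_pos (by positivity) (by nlinarith)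
  have hl : (c * u * W - u / W) * (κ * (b * sl * sl)) ≤
      (c * u * W - u / W) * (κ * (sk * sl)) := by gcongr
  have hr : u / W * (sl ^ 2 * (B * (W * √(W ^ 2 - 1)))) ≤
      u / W * (sl ^ 2 * (S * (κ * b) * (W * (W - 1 / (2 * W))))) := by
    have hS : 0 ≤ S * (κ * b) := hB.trans hBS.le
    refine mul_le_mul_of_nonneg_left (mul_le_mul_of_nonneg_left ?_ (sq_nonneg _)) (by positivity)
    exact mul_le_mul hBS.le (mul_le_mul_of_nonneg_left hsqrt (by positivity)) (by positivity) hS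
  refine hr.trans_lt (lt_of_lt_of_le ?_ hl)
  have hW0 : W ≠ 0 := by positivity
  have hWW : W * (1 / W) = 1 := by field_simp
  have hP : 0 < u / W * (sl ^ 2 * (κ * b)) := by positivity
  have e1 : (c * u * W - u / W) * (κ * (b * sl * sl)) =
      (u / W * (sl ^ 2 * (κ * b))) * (c * W ^ 2 - 1) := by
    linear_combination (c * u * W * κ * b * sl ^ 2) * (-hWW)
  have e2 : u / W * (sl ^ 2 * (S * (κ * b) * (W * (W - 1 / (2 * W))))) =
      (u / W * (sl ^ 2 * (κ * b))) * (S * (W ^ 2 - 1 / 2)) := by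
    have : W * (W - 1 / (2 * W)) = W ^ 2 - 1 / 2 := by field_simp
    rw [this]; ring
  rw [e1, e2]
  refine mul_lt_mul_of_pos_left ?_ hP
  rw [hc] at hc4 ⊢
  nlinarith

/-- The conditions at a maximum, reduced to real numbers: `A a` stands for the derivative of h_aa -
λ_a g_aa along z. In `hWS`, the part 4W² ≤ S - 1 serves the gradient term, and 2(k + 1)n ≤ S - 1
serves the trace ∑q_a. -/
theorem interior_max_algebra {n k l : ℕ} (hlk : l + 2 ≤ k) {lam Z A : Fin n → ℝ}
    (hlam : ∀ j, j ≤ k → 0 < elem lam Finset.univ j) {u W S b B : ℝ} (hu : 0 < u) (hW : 1 < W)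
    (hb : 0 < b) (hB : 0 ≤ B) (hBS : B < S * ((k - l) * b))
    (hWS : W ^ 2 * (4 + 2 * ((k + 1) * n)) ≤ S - 1)
    (hF : b * elem lam Finset.univ l ≤ elem lam Finset.univ k)
    (hZ : ∑ a, Z a ^ 2 = u ^ 2 * (W ^ 2 - 1))
    (h1 : ∀ a, Z a = 0 ∨ u * lam a = -((S - 1) * W))
    (h2 : ∀ a, u / W * (-lam a - A a) + u ^ 2 * lam a ^ 2
      - ((S - 1) ^ 2 + 2 * (S - 1)) * (Z a / u) ^ 2 + (S - 1) * (u * W * lam a - 1) ≤ 0)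
    (h3 : ∑ a, quotDeriv lam Finset.univ k l a * A a ≤
      elem lam Finset.univ l ^ 2 * (B * (W * √(W ^ 2 - 1)))) : False := by
  have hk0 : (0 : ℝ) ≤ (k + 1) * n := by positivity
  have hW2 : 1 < W ^ 2 := by nlinarith
  have hc4 : 4 * W ^ 2 ≤ S - 1 := by nlinarith
  have hck : 2 * ((k + 1) * n : ℝ) ≤ S - 1 := by nlinarith
  set c := S - 1 with hc
  have hcpos : 0 < c := by linarith
  set q := quotDeriv lam Finset.univ k l with hq
  have hq0 : ∀ a, 0 ≤ q a := fun a => quotDeriv_nonneg lam hlk hlam (Finset.mem_univ a)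
  obtain ⟨a₀, ha₀⟩ : ∃ a, Z a ≠ 0 := by
    by_contra h
    push Not at h
    simp only [h] at hZ
    have : 0 < u ^ 2 * (W ^ 2 - 1) := mul_pos (by positivity) (by linarith)
    simp at hZ
    rcases hZ with h | h
    · exact hu.ne' h
    · linarith
  have hlam0 : lam a₀ < 0 := by
    have := (h1 a₀).resolve_left ha₀
    have h' : u * lam a₀ < 0 := by rw [this]; nlinarith
    by_contra hh
    push Not at hh
    nlinarith
  have hsum := sum_quotDeriv_le_of_neg lam hlk hlam (Finset.mem_univ a₀) hlam0
  rw [Finset.card_univ, Fintype.card_fin] at hsum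
  -- Here u²λ_a² = c²W² and (Z_a/u)² ≤ W² - 1, and c²W² - (c² + 2c)(W² - 1) = c(c + 2 - 2W²).
  have hterm : ∀ a, Z a ≠ 0 →
      c * (c + 2 - 2 * W ^ 2) ≤ u ^ 2 * lam a ^ 2 - (c ^ 2 + 2 * c) * (Z a / u) ^ 2 := by
    intro a ha
    have e := (h1 a).resolve_left ha
    have e2 : u ^ 2 * lam a ^ 2 = c ^ 2 * W ^ 2 := by
      rw [← mul_pow, e]; ring
    have e3 : (Z a / u) ^ 2 ≤ W ^ 2 - 1 := by
      rw [div_pow, div_le_iff₀ (by positivity), mul_comm, ← hZ]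
      exact Finset.single_le_sum (f := fun a => Z a ^ 2) (fun i _ => sq_nonneg _)
        (Finset.mem_univ a)
    rw [e2]
    nlinarith [mul_le_mul_of_nonneg_left e3 (by positivity : 0 ≤ c ^ 2 + 2 * c)]
  have hpos : 0 ≤ c * (c + 2 - 2 * W ^ 2) := mul_nonneg hcpos.le (by linarith)
  have hterm0 : ∀ a, 0 ≤ u ^ 2 * lam a ^ 2 - (c ^ 2 + 2 * c) * (Z a / u) ^ 2 := by
    intro a
    by_cases ha : Z a = 0
    · rw [ha]; simp; positivity
    · exact hpos.trans (hterm a ha)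
  have hT : q a₀ * (c * (c + 2 - 2 * W ^ 2)) ≤
      ∑ a, q a * (u ^ 2 * lam a ^ 2 - (c ^ 2 + 2 * c) * (Z a / u) ^ 2) := by
    refine (mul_le_mul_of_nonneg_left (hterm a₀ ha₀) (hq0 a₀)).trans ?_
    exact Finset.single_le_sum
      (f := fun a => q a * (u ^ 2 * lam a ^ 2 - (c ^ 2 + 2 * c) * (Z a / u) ^ 2))
      (fun i _ => mul_nonneg (hq0 i) (hterm0 i)) (Finset.mem_univ a₀)
  -- The single direction a₀ pays for the whole trace, because (k + 1)n ≤ c/2 and 2W² ≤ c/2.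
  have hTq : c * ∑ a, q a ≤
      ∑ a, q a * (u ^ 2 * lam a ^ 2 - (c ^ 2 + 2 * c) * (Z a / u) ^ 2) := by
    refine le_trans ?_ hT
    have : c * ∑ a, q a ≤ c * (n * ((k + 1) * q a₀)) := mul_le_mul_of_nonneg_left hsum hcpos.le
    refine this.trans ?_
    have h' : ((k + 1) * n : ℝ) ≤ c + 2 - 2 * W ^ 2 := by linarith
    nlinarith [mul_le_mul_of_nonneg_left h' (mul_nonneg hcpos.le (hq0 a₀))]
  have hEuler := sum_mul_quotDeriv lam Finset.univ k l
  have hall : ∑ a, q a * (u / W * (-lam a - A a) + u ^ 2 * lam a ^ 2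
      - (c ^ 2 + 2 * c) * (Z a / u) ^ 2 + c * (u * W * lam a - 1)) ≤ 0 :=
    Finset.sum_nonpos fun a _ => mul_nonpos_of_nonneg_of_nonpos (hq0 a) (h2 a)
  have hsplit : ∑ a, q a * (u / W * (-lam a - A a) + u ^ 2 * lam a ^ 2
      - (c ^ 2 + 2 * c) * (Z a / u) ^ 2 + c * (u * W * lam a - 1)) =
      (c * u * W - u / W) * (∑ a, lam a * q a) - u / W * (∑ a, q a * A a)
      + ∑ a, q a * (u ^ 2 * lam a ^ 2 - (c ^ 2 + 2 * c) * (Z a / u) ^ 2) - c * ∑ a, q a := by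
    simp only [Finset.mul_sum]
    rw [← Finset.sum_sub_distrib, ← Finset.sum_add_distrib, ← Finset.sum_sub_distrib]
    exact Finset.sum_congr rfl fun a _ => by ring
  rw [hsplit, hEuler] at hall
  have hmain : (c * u * W - u / W) * ((k - l) * (elem lam Finset.univ k * elem lam Finset.univ l))
      ≤ u / W * (elem lam Finset.univ l ^ 2 * (B * (W * √(W ^ 2 - 1)))) := by
    have := mul_le_mul_of_nonneg_left h3 (by positivity : 0 ≤ u / W)
    linarith
  set sk := elem lam Finset.univ k
  set sl := elem lam Finset.univ l
  have hsl : 0 < sl := hlam l (by omega)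
  have hkl : (0 : ℝ) < k - l := by
    have : (l : ℝ) < k := by exact_mod_cast (by omega : l < k)
    linarith
  exact hmain.not_gt (gradient_term_lt hu hW hb hB hkl hBS hc4 hsl hF)

end HypGraph

/-! ### Principal frames and the derivative of σ_j along a curve of forms -/

namespace HypGraph

open Matrix in
open scoped MatrixOrder Matrix.Norms.L2Operator in
/-- Simultaneous diagonalization of a positive definite and a symmetric form. -/
theorem exists_simultaneous_diag {n : ℕ} {G H : Matrix (Fin n) (Fin n) ℝ} (hG : G.PosDef)
    (hH : H.IsHermitian) : ∃ (P : Matrix (Fin n) (Fin n) ℝ) (lam : Fin n → ℝ), IsUnit P.det ∧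
      Pᵀ * G * P = 1 ∧ Pᵀ * H * P = diagonal lam := by
  -- Factor G = BᵀB, diagonalize (B⁻¹)ᵀHB⁻¹ by an orthogonal U, and take P = B⁻¹U.
  obtain ⟨B, hB⟩ := CStarAlgebra.nonneg_iff_eq_star_mul_self.mp
    (Matrix.nonneg_iff_posSemidef.2 hG.posSemidef)
  rw [star_eq_conjTranspose, conjTranspose_eq_transpose_of_trivial] at hB
  have hBu : IsUnit B.det := by
    have h := hG.det_pos.ne'
    rw [hB, det_mul] at h
    exact isUnit_iff_ne_zero.2 (right_ne_zero_of_mul h)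
  have hK : ((B⁻¹)ᵀ * H * B⁻¹).IsHermitian := by
    have := isHermitian_conjTranspose_mul_mul B⁻¹ hH
    rwa [conjTranspose_eq_transpose_of_trivial] at this
  obtain ⟨U, hU⟩ : ∃ U : unitaryGroup (Fin n) ℝ, U = hK.eigenvectorUnitary := ⟨_, rfl⟩
  have hsp := hK.spectral_theorem
  rw [← hU, Unitary.conjStarAlgAut_apply] at hsp
  have h1 : (U : Matrix (Fin n) (Fin n) ℝ)ᵀ * U = 1 := by
    have := Unitary.coe_star_mul_self U
    rwa [Matrix.star_eq_conjTranspose, conjTranspose_eq_transpose_of_trivial] at this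
  rw [Matrix.star_eq_conjTranspose, conjTranspose_eq_transpose_of_trivial] at hsp
  have hUd : IsUnit (U : Matrix (Fin n) (Fin n) ℝ).det := by
    have := congrArg det h1
    rw [det_mul, det_one] at this
    exact IsUnit.of_mul_eq_one_right _ this
  refine ⟨B⁻¹ * U, hK.eigenvalues, ?_, ?_, ?_⟩
  · rw [det_mul]
    exact (isUnit_nonsing_inv_det _ hBu).mul hUd
  · have e : (B⁻¹)ᵀ * Bᵀ = 1 := by rw [← transpose_mul, mul_nonsing_inv _ hBu, transpose_one]
    calc (B⁻¹ * (U : Matrix (Fin n) (Fin n) ℝ))ᵀ * G * (B⁻¹ * U)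
        = (U : Matrix (Fin n) (Fin n) ℝ)ᵀ * (((B⁻¹)ᵀ * Bᵀ) * (B * B⁻¹)) * U := by
          rw [hB, transpose_mul]; simp only [Matrix.mul_assoc]
      _ = 1 := by rw [e, mul_nonsing_inv _ hBu, Matrix.mul_one, Matrix.mul_one, h1]
  · calc (B⁻¹ * (U : Matrix (Fin n) (Fin n) ℝ))ᵀ * H * (B⁻¹ * U)
        = (U : Matrix (Fin n) (Fin n) ℝ)ᵀ * ((B⁻¹)ᵀ * H * B⁻¹) * U := by
          rw [transpose_mul]; simp only [Matrix.mul_assoc]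
      _ = ((U : Matrix (Fin n) (Fin n) ℝ)ᵀ * (U : Matrix (Fin n) (Fin n) ℝ)) *
          (Matrix.diagonal (RCLike.ofReal ∘ hK.eigenvalues) : Matrix (Fin n) (Fin n) ℝ) *
          ((U : Matrix (Fin n) (Fin n) ℝ)ᵀ * U) := by
          conv_lhs => rw [hsp]
          simp only [Matrix.mul_assoc]
      _ = _ := by rw [h1, Matrix.mul_one, Matrix.one_mul]; rfl

section Diag

open Matrix

variable {n : ℕ} {G H P : Matrix (Fin n) (Fin n) ℝ} {lam : Fin n → ℝ}

/-- Since G⁻¹ = PPᵀ, the matrix G⁻¹H is conjugate by P to the diagonal one. -/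
theorem charpoly_roots_of_diag (hP : IsUnit P.det) (hG : Pᵀ * G * P = 1)
    (hH : Pᵀ * H * P = diagonal lam) :
    (G⁻¹ * H).charpoly.roots = Finset.univ.val.map lam := by
  have hinv : G⁻¹ = P * Pᵀ := by
    refine inv_eq_left_inv ?_
    have h : P * (Pᵀ * G) = 1 := mul_eq_one_comm.1 hG
    rw [Matrix.mul_assoc, h]
  have h2 : G⁻¹ * H = P * diagonal lam * P⁻¹ := by
    rw [hinv, ← hH]
    simp only [Matrix.mul_assoc]
    rw [mul_nonsing_inv _ hP, Matrix.mul_one]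
  obtain ⟨U, rfl⟩ := (isUnit_iff_isUnit_det P).2 hP
  rw [h2, charpoly_units_conj, charpoly_diagonal]
  rw [Finset.prod_eq_multiset_prod]
  have := Polynomial.roots_multiset_prod_X_sub_C (Finset.univ.val.map lam)
  rwa [Multiset.map_map] at this

/-- The left side does not mention eigenvalues. By interpolation in s, each σ_j becomes a fixed
combination of such quotients, hence differentiable in the entries even where eigenvalues collide.
-/
theorem det_add_smul_of_diag (hG : Pᵀ * G * P = 1) (hH : Pᵀ * H * P = diagonal lam) (s : ℝ) :
    (G + s • H).det / G.det = (genPoly lam Finset.univ).eval s := by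
  have h1 : P.det * P.det * G.det = 1 := by
    have := congrArg det hG
    rw [det_mul, det_mul, det_transpose, det_one] at this
    linarith
  have hG0 : G.det ≠ 0 := right_ne_zero_of_mul (h1.trans_ne one_ne_zero)
  have h2 : Pᵀ * (G + s • H) * P = diagonal fun a => 1 + s * lam a := by
    rw [Matrix.mul_add, Matrix.add_mul, hG, Matrix.mul_smul, Matrix.smul_mul, hH]
    ext i j
    by_cases hij : i = j
    · subst hij; simp
    · simp [hij]
  have h3 := congrArg det h2
  rw [det_mul, det_mul, det_transpose, det_diagonal] at h3
  have h4 : (genPoly lam Finset.univ).eval s = ∏ a, (1 + s * lam a) := by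
    simp only [genPoly, Polynomial.eval_prod, Polynomial.eval_add, Polynomial.eval_one,
      Polynomial.eval_mul, Polynomial.eval_C, Polynomial.eval_X, mul_comm s]
  rw [h4, ← h3, div_eq_iff hG0]
  linear_combination (-(G + s • H).det) * h1

end Diag

/-- The derivative of the determinant along a curve through a diagonal matrix. -/
theorem hasDerivAt_det_of_diagonal {n : ℕ} {M : ℝ → Matrix (Fin n) (Fin n) ℝ}
    {M' : Matrix (Fin n) (Fin n) ℝ} {d : Fin n → ℝ} {t : ℝ}
    (hM : ∀ i j, HasDerivAt (fun t => M t i j) (M' i j) t) (h0 : M t = Matrix.diagonal d) :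
    HasDerivAt (fun t => (M t).det) (∑ a, M' a a * ∏ b ∈ Finset.univ.erase a, d b) t := by
  simp only [Matrix.det_apply, ← Int.cast_smul_eq_zsmul ℝ, smul_eq_mul, Units.smul_def]
  have h1 : ∀ σ : Equiv.Perm (Fin n), HasDerivAt
      (fun t => ((Equiv.Perm.sign σ : ℤ) : ℝ) * ∏ i, M t (σ i) i)
      (((Equiv.Perm.sign σ : ℤ) : ℝ) *
        ∑ i, (∏ j ∈ Finset.univ.erase i, M t (σ j) j) • M' (σ i) i) t := by
    intro σ
    refine HasDerivAt.const_mul _ ?_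
    have := HasDerivAt.finsetProd (u := Finset.univ) (f := fun i t => M t (σ i) i)
      (f' := fun i => M' (σ i) i) (x := t) fun i _ => hM (σ i) i
    simpa only [Finset.prod_fn] using! this
  refine (HasDerivAt.fun_sum fun σ _ => h1 σ).congr_deriv ?_
  rw [Finset.sum_eq_single 1]
  · simp only [Equiv.Perm.sign_one, Units.val_one, Int.cast_one, one_mul, Equiv.Perm.coe_one, id,
      smul_eq_mul]
    refine Finset.sum_congr rfl fun i _ => ?_
    rw [mul_comm]
    congr 1
    refine Finset.prod_congr rfl fun j _ => ?_
    rw [h0, Matrix.diagonal_apply_eq]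
  · intro σ _ hσ
    refine mul_eq_zero_of_right _ (Finset.sum_eq_zero fun i _ => ?_)
    -- A nontrivial permutation moves at least two indices, so an off-diagonal zero survives the
    -- removal of one factor.
    have : ∃ j, j ≠ i ∧ σ j ≠ j := by
      by_contra hc
      push Not at hc
      refine hσ (Equiv.ext fun j => ?_)
      by_cases hj : j = i
      · subst hj
        by_contra hne
        exact hne (σ.injective (hc (σ j) hne))
      · exact hc j hj
    obtain ⟨j, hji, hj⟩ := this
    rw [Finset.prod_eq_zero (Finset.mem_erase.2 ⟨hji, Finset.mem_univ j⟩), zero_smul]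
    rw [h0, Matrix.diagonal_apply_ne _ hj]
  · simp

/-- Weights expressing the coefficients of a polynomial of degree at most `n` by its values at
`0, …, n`. -/
theorem exists_coeff_weights (n j : ℕ) : ∃ w : ℕ → ℝ, ∀ p : Polynomial ℝ, p.natDegree ≤ n →
    p.coeff j = ∑ i ∈ Finset.range (n + 1), w i * p.eval (i : ℝ) := by
  refine ⟨fun i => (Lagrange.basis (Finset.range (n + 1)) (fun i : ℕ => (i : ℝ)) i).coeff j,
    fun p hp => ?_⟩
  have h := Lagrange.eq_interpolate (s := Finset.range (n + 1)) (v := fun i : ℕ => (i : ℝ))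
    (f := p) (fun a _ b _ hab => Nat.cast_injective hab) (by
      rw [Finset.card_range]
      exact (Polynomial.degree_le_of_natDegree_le hp).trans_lt (by exact_mod_cast Nat.lt_succ_self n))
  conv_lhs => rw [h]
  rw [Lagrange.interpolate_apply, Polynomial.finsetSum_coeff]
  exact Finset.sum_congr rfl fun i _ => by rw [Polynomial.coeff_C_mul, mul_comm]

section Derivative

variable {n : ℕ} {G H : ℝ → Matrix (Fin n) (Fin n) ℝ} {G' H' : Matrix (Fin n) (Fin n) ℝ}
  {lam : Fin n → ℝ} {t : ℝ}

-- By the quotient rule the a-th factor contributes G'_aa + sH'_aa - (1 + sλ_a)G'_aa = s(H'_aa -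
-- λ_aG'_aa). The factor s is the X that also appears in `elemDeriv`.
open Matrix Polynomial in
theorem hasDerivAt_det_quotient (hG : ∀ i j, HasDerivAt (fun t => G t i j) (G' i j) t)
    (hH : ∀ i j, HasDerivAt (fun t => H t i j) (H' i j) t) (hG0 : G t = 1)
    (hH0 : H t = diagonal lam) (s : ℝ) :
    HasDerivAt (fun t => (G t + s • H t).det / (G t).det)
      ((∑ a, C (H' a a - lam a * G' a a) * (X * genPoly lam (Finset.univ.erase a))).eval s) t := by
  have h1 := hasDerivAt_det_of_diagonal (d := fun _ => 1) hG (by rw [hG0, diagonal_one])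
  have h2 := hasDerivAt_det_of_diagonal (M := fun t => G t + s • H t) (M' := G' + s • H')
    (d := fun a => 1 + s * lam a) (t := t)
    (fun i j => (hG i j).fun_add ((hH i j).const_mul s)) (by
      rw [hG0, hH0]
      ext i j
      by_cases hij : i = j
      · subst hij; simp
      · simp [hij])
  have hne : (G t).det ≠ 0 := by rw [hG0, det_one]; exact one_ne_zero
  refine (h2.div h1 hne).congr_deriv ?_
  have hd : (G t + s • H t).det = ∏ a, (1 + s * lam a) := by
    rw [← det_diagonal]
    congr 1
    rw [hG0, hH0]
    ext i j
    by_cases hij : i = j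
    · subst hij; simp
    · simp [hij]
  rw [hd, hG0, det_one, one_pow, div_one, mul_one, eval_finsetSum, Finset.mul_sum,
    ← Finset.sum_sub_distrib]
  refine Finset.sum_congr rfl fun a _ => ?_
  rw [← Finset.mul_prod_erase Finset.univ _ (Finset.mem_univ a)]
  simp only [genPoly, eval_mul, eval_C, eval_X, eval_prod, eval_add, eval_one, Finset.prod_const_one,
    Matrix.add_apply, Matrix.smul_apply, smul_eq_mul, mul_comm s]
  ring

open Matrix Polynomial in
/-- The derivative of the elementary symmetric functions of the eigenvalues of `H` with respect
to `G`, along a curve through a diagonal pair. -/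
theorem hasDerivAt_elem (hG : ∀ i j, HasDerivAt (fun t => G t i j) (G' i j) t)
    (hH : ∀ i j, HasDerivAt (fun t => H t i j) (H' i j) t) (hG0 : G t = 1)
    (hH0 : H t = diagonal lam) (j : ℕ) {e : ℝ → ℝ} {w : ℕ → ℝ}
    (hw : ∀ p : ℝ[X], p.natDegree ≤ n →
      p.coeff j = ∑ i ∈ Finset.range (n + 1), w i * p.eval (i : ℝ))
    (he : e =ᶠ[nhds t] fun t => ∑ i ∈ Finset.range (n + 1),
      w i * ((G t + (i : ℝ) • H t).det / (G t).det)) :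
    HasDerivAt e (∑ a, elemDeriv lam Finset.univ j a * (H' a a - lam a * G' a a)) t := by
  have h := HasDerivAt.fun_sum (u := Finset.range (n + 1)) fun i _ =>
    (hasDerivAt_det_quotient hG hH hG0 hH0 (i : ℝ)).const_mul (w i)
  refine (h.congr_of_eventuallyEq he).congr_deriv ?_
  -- The same weights extract the j-th coefficient of the derivative, which as a polynomial in s
  -- still has degree at most n: X times n - 1 linear factors.
  rw [← hw]
  · rw [finsetSum_coeff]
    refine Finset.sum_congr rfl fun a _ => ?_
    rw [coeff_C_mul, mul_comm]
    rfl
  · refine natDegree_sum_le_of_forall_le _ _ fun a _ => ?_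
    refine (natDegree_C_mul_le _ _).trans ((natDegree_mul_le).trans ?_)
    have := natDegree_genPoly_le lam (Finset.univ.erase a)
    rw [Finset.card_erase_of_mem (Finset.mem_univ a), Finset.card_univ, Fintype.card_fin] at this
    have hn : 0 < n := a.pos
    rw [natDegree_X]
    omega

end Derivative

end HypGraph

/-! ### Lorentzian algebra and second-order calculus along lines -/

namespace HypGraph

open Filter Topology

section Lorentz

variable {n : ℕ}

/-- The Lorentzian product as a continuous bilinear form. -/
noncomputable def lorentzL (n : ℕ) : Mink n →L[ℝ] Mink n →L[ℝ] ℝ :=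
  (innerSL ℝ).bilinearComp (ContinuousLinearMap.fst ℝ _ _) (ContinuousLinearMap.fst ℝ _ _) -
    (ContinuousLinearMap.mul ℝ ℝ).bilinearComp (ContinuousLinearMap.snd ℝ _ _)
      (ContinuousLinearMap.snd ℝ _ _)

theorem lorentz_eq_inner (X Y : Mink n) : lorentz X Y = inner ℝ X.1 Y.1 - X.2 * Y.2 := by
  simp [lorentz, PiLp.inner_apply, mul_comm]

theorem lorentzL_apply (X Y : Mink n) : lorentzL n X Y = lorentz X Y := by
  simp [lorentzL, lorentz_eq_inner]

theorem lorentz_comm (X Y : Mink n) : lorentz X Y = lorentz Y X := by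
  rw [lorentz_eq_inner, lorentz_eq_inner, real_inner_comm, mul_comm]

theorem lorentz_add_left (X Y V : Mink n) : lorentz (X + Y) V = lorentz X V + lorentz Y V := by
  simp only [← lorentzL_apply, map_add, add_apply]

theorem lorentz_add_right (X Y V : Mink n) : lorentz V (X + Y) = lorentz V X + lorentz V Y := by
  simp only [← lorentzL_apply, map_add]

theorem lorentz_smul_left (c : ℝ) (X V : Mink n) : lorentz (c • X) V = c * lorentz X V := by
  simp only [← lorentzL_apply, map_smul, smul_apply, smul_eq_mul]

theorem lorentz_smul_right (c : ℝ) (X V : Mink n) : lorentz V (c • X) = c * lorentz V X := by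
  simp only [← lorentzL_apply, map_smul, smul_eq_mul]

theorem lorentz_sub_left (X Y V : Mink n) : lorentz (X - Y) V = lorentz X V - lorentz Y V := by
  simp only [← lorentzL_apply, map_sub, sub_apply]

theorem lorentz_sum_left {ι : Type*} (s : Finset ι) (f : ι → Mink n) (V : Mink n) :
    lorentz (∑ i ∈ s, f i) V = ∑ i ∈ s, lorentz (f i) V := by
  simp only [← lorentzL_apply, map_sum, sum_apply]

theorem lorentz_sum_right {ι : Type*} (s : Finset ι) (f : ι → Mink n) (V : Mink n) :
    lorentz V (∑ i ∈ s, f i) = ∑ i ∈ s, lorentz V (f i) := by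
  simp only [← lorentzL_apply, map_sum]

theorem _root_.HasDerivAt.lorentz {p q : ℝ → Mink n} {p' q' : Mink n} {t : ℝ}
    (hp : HasDerivAt p p' t) (hq : HasDerivAt q q' t) :
    HasDerivAt (fun t => HypGraph.lorentz (p t) (q t))
      (HypGraph.lorentz p' (q t) + HypGraph.lorentz (p t) q') t := by
  have := (lorentzL n).hasDerivAt_of_bilinear (fun _ => hp) (fun _ => hq)
  simpa only [lorentzL_apply, add_comm] using this

/-- A vector orthogonal to a Lorentzian orthonormal frame vanishes. -/
theorem eq_zero_of_lorentz_frame {T : Fin n → Mink n} {ν V : Mink n}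
    (hT : ∀ a b, lorentz (T a) (T b) = if a = b then 1 else 0)
    (hTν : ∀ a, lorentz (T a) ν = 0) (hν : lorentz ν ν = -1)
    (hV : ∀ a, lorentz V (T a) = 0) (hVν : lorentz V ν = 0) : V = 0 := by
  let F : Option (Fin n) → Mink n := fun o => o.elim ν T
  have hli : LinearIndependent ℝ F := by
    rw [Fintype.linearIndependent_iff]
    intro g hg
    rw [Fintype.sum_option] at hg
    simp only [F, Option.elim] at hg
    intro o
    cases o with
    | none =>
      have := congrArg (fun Y => lorentz Y ν) hg
      simp only [lorentz_add_left, lorentz_smul_left, lorentz_sum_left, hTν, hν] at this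
      simpa [lorentz] using this
    | some a =>
      have := congrArg (fun Y => lorentz Y (T a)) hg
      simp only [lorentz_add_left, lorentz_smul_left, lorentz_sum_left, hT,
        lorentz_comm ν (T a), hTν] at this
      simpa [lorentz] using this
  have hspan : Submodule.span ℝ (Set.range F) = ⊤ := by
    refine hli.span_eq_top_of_card_eq_finrank' ?_
    simp
  have hall : ∀ Y : Mink n, lorentz V Y = 0 := by
    intro Y
    have hY : Y ∈ Submodule.span ℝ (Set.range F) := by rw [hspan]; trivial
    induction hY using Submodule.span_induction with
    | mem x hx =>
      obtain ⟨o, rfl⟩ := hx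
      cases o with
      | none => exact hVν
      | some a => exact hV a
    | zero => simp [lorentz]
    | add x y _ _ hx hy => rw [lorentz_add_right, hx, hy, add_zero]
    | smul c x _ hx => rw [lorentz_smul_right, hx, mul_zero]
  -- The product of V with its time reflection is the Euclidean square of V.
  have h := hall (V.1, -V.2)
  rw [lorentz_eq_inner, real_inner_self_eq_norm_sq] at h
  simp only at h
  have h1 : ‖V.1‖ = 0 := by nlinarith [sq_nonneg ‖V.1‖, sq_nonneg V.2]
  have h2 : V.2 = 0 := by nlinarith [sq_nonneg ‖V.1‖, sq_nonneg V.2]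
  exact Prod.ext (norm_eq_zero.1 h1) h2

end Lorentz

/-- First and second order conditions at a local maximum on the line. -/
theorem deriv_conditions_of_isLocalMax {g g₁ : ℝ → ℝ} {g₂ t : ℝ} (hmax : IsLocalMax g t)
    (h₁ : ∀ᶠ s in 𝓝 t, HasDerivAt g (g₁ s) s) (h₂ : HasDerivAt g₁ g₂ t) :
    g₁ t = 0 ∧ g₂ ≤ 0 := by
  have h0 : g₁ t = 0 := hmax.hasDerivAt_eq_zero h₁.self_of_nhds
  refine ⟨h0, ?_⟩
  by_contra hg
  push Not at hg
  have hd : deriv g =ᶠ[𝓝 t] g₁ := h₁.mono fun s hs => hs.deriv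
  have hdd : deriv (deriv g) t = g₂ := by rw [hd.deriv_eq, h₂.deriv]
  -- If g'' > 0, the point is also a local minimum, so g is locally constant and g'' = 0.
  have hmin := isLocalMin_of_deriv_deriv_pos (f := g) (by rw [hdd]; exact hg)
    (by rw [h₁.self_of_nhds.deriv, h0]) h₁.self_of_nhds.continuousAt
  have hconst : g =ᶠ[𝓝 t] fun _ => g t := by
    filter_upwards [hmax, hmin] with s h1 h2 using le_antisymm h1 h2
  have : deriv g =ᶠ[𝓝 t] fun _ => 0 := by simpa using hconst.deriv
  rw [this.deriv_eq] at hdd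
  simp at hdd
  exact hg.ne hdd

/-- A curve with its first two derivatives at a point. -/
structure HasTwoDerivs {F : Type*} [NormedAddCommGroup F] [NormedSpace ℝ F] (p p₁ : ℝ → F)
    (p₂ : F) (t : ℝ) : Prop where
  first : ∀ᶠ s in 𝓝 t, HasDerivAt p (p₁ s) s
  second : HasDerivAt p₁ p₂ t

section

variable {n : ℕ} {p p₁ q q₁ : ℝ → Mink n} {p₂ q₂ : Mink n} {t : ℝ}

theorem HasTwoDerivs.lorentz (hp : HasTwoDerivs p p₁ p₂ t) (hq : HasTwoDerivs q q₁ q₂ t) :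
    HasTwoDerivs (fun s => HypGraph.lorentz (p s) (q s))
      (fun s => HypGraph.lorentz (p₁ s) (q s) + HypGraph.lorentz (p s) (q₁ s))
      (HypGraph.lorentz p₂ (q t) + 2 * HypGraph.lorentz (p₁ t) (q₁ t) +
        HypGraph.lorentz (p t) q₂) t := by
  refine ⟨?_, ?_⟩
  · filter_upwards [hp.first, hq.first] with s h1 h2 using h1.lorentz h2
  · refine ((hp.second.lorentz hq.first.self_of_nhds).fun_add
      (hp.first.self_of_nhds.lorentz hq.second)).congr_deriv ?_
    ring

theorem HasTwoDerivs.eq_zero_of_const {f f₁ : ℝ → ℝ} {f₂ t c : ℝ} (hf : HasTwoDerivs f f₁ f₂ t)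
    (hc : ∀ᶠ s in 𝓝 t, f s = c) : f₁ t = 0 ∧ f₂ = 0 := by
  have h1 : ∀ᶠ s in 𝓝 t, f₁ s = 0 := by
    filter_upwards [hf.first, eventually_eventually_nhds.2 hc] with s h1 h2
    exact h1.unique ((hasDerivAt_const s c).congr_of_eventuallyEq h2)
  exact ⟨h1.self_of_nhds,
    hf.second.unique ((hasDerivAt_const t (0 : ℝ)).congr_of_eventuallyEq h1)⟩

theorem HasTwoDerivs.log {f f₁ : ℝ → ℝ} {f₂ t : ℝ} (hf : HasTwoDerivs f f₁ f₂ t) (h0 : f t ≠ 0) :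
    HasTwoDerivs (fun s => Real.log (f s)) (fun s => f₁ s / f s)
      (f₂ / f t - (f₁ t / f t) ^ 2) t := by
  refine ⟨?_, ?_⟩
  · filter_upwards [hf.first, hf.first.self_of_nhds.continuousAt.eventually_ne h0] with s h1 h2
      using h1.log h2
  · refine (hf.second.div hf.first.self_of_nhds h0).congr_deriv ?_
    field_simp

end

section Line

variable {E F : Type*} [NormedAddCommGroup E] [NormedSpace ℝ E] [NormedAddCommGroup F]
  [NormedSpace ℝ F]

theorem hasDerivAt_line {f : E → F} {ξ e : E} {t : ℝ} (hf : DifferentiableAt ℝ f (ξ + t • e)) :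
    HasDerivAt (fun s : ℝ => f (ξ + s • e)) (fderiv ℝ f (ξ + t • e) e) t := by
  have h : HasDerivAt (fun s : ℝ => ξ + s • e) e t := by
    simpa using ((hasDerivAt_id t).smul_const e).const_add ξ
  exact hf.hasFDerivAt.comp_hasDerivAt t h

theorem tendsto_line (ξ e : E) : Tendsto (fun s : ℝ => ξ + s • e) (𝓝 0) (𝓝 ξ) := by
  have : ContinuousAt (fun s : ℝ => ξ + s • e) 0 := by fun_prop
  simpa [ContinuousAt] using this

/-- Straight lines of the chart replace covariant differentiation: only ordinary derivatives of maps
into Minkowski space are taken. -/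
theorem hasTwoDerivs_line {f : E → F} {ξ : E} (hf : ContDiffAt ℝ 2 f ξ) (e : E) :
    HasTwoDerivs (fun s : ℝ => f (ξ + s • e)) (fun s => fderiv ℝ f (ξ + s • e) e)
      (fderiv ℝ (fderiv ℝ f) ξ e e) 0 := by
  refine ⟨?_, ?_⟩
  · have h1 : ∀ᶠ η in 𝓝 ξ, DifferentiableAt ℝ f η := by
      filter_upwards [hf.eventually (by simp)] with η hη using hη.differentiableAt (by simp)
    filter_upwards [(tendsto_line ξ e).eventually h1] with s hs using hasDerivAt_line hs
  · have h2 : DifferentiableAt ℝ (fderiv ℝ f) (ξ + (0 : ℝ) • e) := by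
      rw [zero_smul, add_zero]
      exact (hf.fderiv_right (m := 1) (by norm_num)).differentiableAt (by simp)
    have := (hasDerivAt_line h2).clm_apply (hasDerivAt_const (0 : ℝ) e)
    simpa using this

end Line

end HypGraph

/-! ### Hypersurfaces of Minkowski space and conditions at a maximum -/

namespace HypGraph

open Filter Topology

theorem HasTwoDerivs.clm_apply {E F : Type*} [NormedAddCommGroup E] [NormedSpace ℝ E]
    [NormedAddCommGroup F] [NormedSpace ℝ F] {p p₁ : ℝ → E →L[ℝ] F} {p₂ : E →L[ℝ] F} {t : ℝ}
    (hp : HasTwoDerivs p p₁ p₂ t) (w : E) :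
    HasTwoDerivs (fun s => p s w) (fun s => p₁ s w) (p₂ w) t := by
  refine ⟨?_, ?_⟩
  · filter_upwards [hp.first] with s hs
    simpa using hs.clm_apply (hasDerivAt_const s w)
  · simpa using hp.second.clm_apply (hasDerivAt_const t w)

/-- The outer two slots commute by symmetry of the second derivative of DX, the inner two by
differentiating the symmetry of D²X. This carries the content of the Codazzi equation. -/
theorem fderiv_three_symm {E F : Type*} [NormedAddCommGroup E] [NormedSpace ℝ E]
    [NormedAddCommGroup F] [NormedSpace ℝ F] {X : E → F} {ξ : E} (hX : ContDiffAt ℝ 3 X ξ)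
    (a w : E) : fderiv ℝ (fderiv ℝ (fderiv ℝ X)) ξ a a w =
      fderiv ℝ (fderiv ℝ (fderiv ℝ X)) ξ w a a := by
  have h1 : ContDiffAt ℝ 2 (fderiv ℝ X) ξ := hX.fderiv_right (by norm_num)
  have h2 : ContDiffAt ℝ 1 (fderiv ℝ (fderiv ℝ X)) ξ := h1.fderiv_right (by norm_num)
  have hs : fderiv ℝ (fderiv ℝ (fderiv ℝ X)) ξ w a =
      fderiv ℝ (fderiv ℝ (fderiv ℝ X)) ξ a w :=
    (h1.isSymmSndFDerivAt (by simp)) w a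
  rw [hs]
  have hl := hasDerivAt_line (f := fderiv ℝ (fderiv ℝ X)) (ξ := ξ) (e := a) (t := 0)
    (by rw [zero_smul, add_zero]; exact h2.differentiableAt (by simp))
  rw [zero_smul, add_zero] at hl
  have e1 : HasDerivAt (fun s : ℝ => fderiv ℝ (fderiv ℝ X) (ξ + s • a) a w)
      (fderiv ℝ (fderiv ℝ (fderiv ℝ X)) ξ a a w) 0 := by
    simpa using (hl.clm_apply (hasDerivAt_const (0 : ℝ) a)).clm_apply (hasDerivAt_const (0 : ℝ) w)
  have e2 : HasDerivAt (fun s : ℝ => fderiv ℝ (fderiv ℝ X) (ξ + s • a) w a)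
      (fderiv ℝ (fderiv ℝ (fderiv ℝ X)) ξ a w a) 0 := by
    simpa using (hl.clm_apply (hasDerivAt_const (0 : ℝ) w)).clm_apply (hasDerivAt_const (0 : ℝ) a)
  refine e1.unique (e2.congr_of_eventuallyEq ?_)
  have hev : ∀ᶠ η in 𝓝 ξ, ContDiffAt ℝ 3 X η := hX.eventually (by simp)
  filter_upwards [(tendsto_line ξ a).eventually hev] with s hs
  exact (hs.isSymmSndFDerivAt (by simp; norm_num)) a w

/-- A parametrized hypersurface of Minkowski space with a unit timelike normal field. -/
structure IsHypersurfaceAt {n : ℕ} (X N : EuclideanSpace ℝ (Fin n) → Mink n)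
    (ξ : EuclideanSpace ℝ (Fin n)) : Prop where
  contDiffAt : ContDiffAt ℝ 3 X ξ
  contDiffAt_normal : ContDiffAt ℝ 2 N ξ
  unit : ∀ᶠ η in 𝓝 ξ, lorentz (N η) (N η) = -1
  orthogonal : ∀ᶠ η in 𝓝 ξ, ∀ w, lorentz (fderiv ℝ X η w) (N η) = 0

namespace IsHypersurfaceAt

variable {n : ℕ} {X N : EuclideanSpace ℝ (Fin n) → Mink n} {ξ : EuclideanSpace ℝ (Fin n)}
  (h : IsHypersurfaceAt X N ξ)

include h

theorem normal_deriv (a : EuclideanSpace ℝ (Fin n)) :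
    lorentz (N ξ) (fderiv ℝ N ξ a) = 0 ∧
      lorentz (N ξ) (fderiv ℝ (fderiv ℝ N) ξ a a) =
        -lorentz (fderiv ℝ N ξ a) (fderiv ℝ N ξ a) := by
  have hN := hasTwoDerivs_line h.contDiffAt_normal a
  have := (hN.lorentz hN).eq_zero_of_const ((tendsto_line ξ a).eventually h.unit)
  simp only [zero_smul, add_zero] at this
  rw [lorentz_comm (fderiv ℝ N ξ a) (N ξ),
    lorentz_comm (fderiv ℝ (fderiv ℝ N) ξ a a) (N ξ)] at this
  constructor <;> linarith [this.1, this.2]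

/-- Two derivatives of ⟨X_w, N⟩ = 0 along a. The third derivative is reordered with w outermost, so
that it reads as part of the derivative of h_aa along w. -/
theorem tangent_deriv (a w : EuclideanSpace ℝ (Fin n)) :
    lorentz (fderiv ℝ (fderiv ℝ X) ξ a w) (N ξ) +
        lorentz (fderiv ℝ X ξ w) (fderiv ℝ N ξ a) = 0 ∧
      lorentz (fderiv ℝ (fderiv ℝ (fderiv ℝ X)) ξ w a a) (N ξ) +
        2 * lorentz (fderiv ℝ (fderiv ℝ X) ξ a w) (fderiv ℝ N ξ a) +
        lorentz (fderiv ℝ X ξ w) (fderiv ℝ (fderiv ℝ N) ξ a a) = 0 := by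
  have hN := hasTwoDerivs_line h.contDiffAt_normal a
  have hX := (hasTwoDerivs_line (f := fderiv ℝ X) (ξ := ξ)
    (h.contDiffAt.fderiv_right (by norm_num)) a).clm_apply w
  have := (hX.lorentz hN).eq_zero_of_const (c := 0)
    ((tendsto_line ξ a).eventually (h.orthogonal.mono fun η hη => hη w))
  simp only [zero_smul, add_zero] at this
  rwa [fderiv_three_symm h.contDiffAt] at this

/-- The Weingarten equation in a frame of principal directions. -/
theorem weingarten_eq {T : Fin n → EuclideanSpace ℝ (Fin n)} {lam : Fin n → ℝ}
    (hG : ∀ a b, lorentz (fderiv ℝ X ξ (T a)) (fderiv ℝ X ξ (T b)) = if a = b then 1 else 0)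
    (hH : ∀ a b, -lorentz (fderiv ℝ (fderiv ℝ X) ξ (T a) (T b)) (N ξ) =
      if a = b then lam a else 0) (a : Fin n) :
    fderiv ℝ N ξ (T a) = lam a • fderiv ℝ X ξ (T a) := by
  rw [← sub_eq_zero]
  refine eq_zero_of_lorentz_frame hG (fun b => h.orthogonal.self_of_nhds _)
    h.unit.self_of_nhds (fun b => ?_) ?_
  · have h1 := (h.tangent_deriv (T a) (T b)).1
    have h2 := hH a b
    rw [lorentz_sub_left, lorentz_smul_left, hG, lorentz_comm]
    split_ifs at h2 ⊢ <;> linarith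
  · rw [lorentz_sub_left, lorentz_smul_left, h.orthogonal.self_of_nhds, lorentz_comm,
      (h.normal_deriv _).1]
    ring

/-- The conditions satisfied, in a frame of principal directions, at a local maximum of
`ln ϑ + c ln |X|`. -/
theorem conditions_of_isLocalMax {T : Fin n → EuclideanSpace ℝ (Fin n)} {lam Z : Fin n → ℝ}
    {z : EuclideanSpace ℝ (Fin n)} {u W c : ℝ}
    (hG : ∀ a b, lorentz (fderiv ℝ X ξ (T a)) (fderiv ℝ X ξ (T b)) = if a = b then 1 else 0)
    (hH : ∀ a b, -lorentz (fderiv ℝ (fderiv ℝ X) ξ (T a) (T b)) (N ξ) =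
      if a = b then lam a else 0)
    (hu : 0 < u) (hW : 0 < W) (hz : z = ∑ a, Z a • T a)
    (hX : X ξ = fderiv ℝ X ξ z + (u * W) • N ξ) (hXX : lorentz (X ξ) (X ξ) = -u ^ 2)
    (hmax : IsLocalMax (fun η => Real.log (-lorentz (X η) (N η)) +
      c / 2 * Real.log (-lorentz (X η) (X η))) ξ) (a : Fin n) :
    (Z a = 0 ∨ u * lam a = -(c * W)) ∧
      u / W * (-lam a - (-lorentz (fderiv ℝ (fderiv ℝ (fderiv ℝ X)) ξ z (T a) (T a)) (N ξ) -
          lorentz (fderiv ℝ (fderiv ℝ X) ξ (T a) (T a)) (fderiv ℝ N ξ z) -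
          lam a * (2 * lorentz (fderiv ℝ (fderiv ℝ X) ξ z (T a)) (fderiv ℝ X ξ (T a)))))
        + u ^ 2 * lam a ^ 2 - (c ^ 2 + 2 * c) * (Z a / u) ^ 2 + c * (u * W * lam a - 1) ≤ 0 := by
  have hN := hasTwoDerivs_line h.contDiffAt_normal
  have hX2 := hasTwoDerivs_line (h.contDiffAt.of_le (by norm_num : (2 : WithTop ℕ∞) ≤ 3))
  have hνν := h.unit.self_of_nhds
  have hXν : ∀ w, lorentz (fderiv ℝ X ξ w) (N ξ) = 0 := h.orthogonal.self_of_nhds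
  have hθ : lorentz (X ξ) (N ξ) = -(u * W) := by
    rw [hX, lorentz_add_left, hXν, lorentz_smul_left, hνν]; ring
  have hXT : ∀ b, lorentz (X ξ) (fderiv ℝ X ξ (T b)) = Z b := by
    intro b
    rw [hX, lorentz_add_left, lorentz_smul_left, lorentz_comm (N ξ), hXν, hz, map_sum,
      lorentz_sum_left]
    simp [map_smul, lorentz_smul_left, hG]
  have hWein := h.weingarten_eq hG hH
  have hneg : ∀ {f f₁ : ℝ → ℝ} {f₂ t : ℝ}, HasTwoDerivs f f₁ f₂ t →
      HasTwoDerivs (fun s => -f s) (fun s => -f₁ s) (-f₂) t := fun hf =>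
    ⟨hf.first.mono fun s hs => hs.fun_neg, hf.second.fun_neg⟩
  -- The one-variable conditions on the line through ξ in the direction T_b, using N_b = λ_b X_b and
  -- ⟨X, X_b⟩ = Z_b.
  have cond : ∀ b, (u * lam b + c * W) * Z b = 0 ∧
      (-(lorentz (fderiv ℝ (fderiv ℝ X) ξ (T b) (T b)) (N ξ) + 2 * lorentz (fderiv ℝ X ξ (T b))
        (fderiv ℝ N ξ (T b)) + lorentz (X ξ) (fderiv ℝ (fderiv ℝ N) ξ (T b) (T b)))) / (u * W)
        - (lam b * Z b / (u * W)) ^ 2 + c / 2 * (-(2 + 2 * lorentz (X ξ)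
          (fderiv ℝ (fderiv ℝ X) ξ (T b) (T b))) / u ^ 2 - (2 * Z b / u ^ 2) ^ 2) ≤ 0 := by
    intro b
    have hl1 := (hneg ((hX2 (T b)).lorentz (hN (T b)))).log (by
      simp only [zero_smul, add_zero, hθ, neg_neg]; positivity)
    have hl2 := (hneg ((hX2 (T b)).lorentz (hX2 (T b)))).log (by
      simp only [zero_smul, add_zero, hXX, neg_neg]; positivity)
    have hmax' : IsLocalMax (fun s : ℝ => Real.log (-lorentz (X (ξ + s • T b)) (N (ξ + s • T b))) +
        c / 2 * Real.log (-lorentz (X (ξ + s • T b)) (X (ξ + s • T b)))) 0 := by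
      have := (tendsto_line ξ (T b)).eventually hmax
      simp only [IsLocalMax, IsMaxFilter, zero_smul, add_zero]
      exact this
    have hfin := deriv_conditions_of_isLocalMax hmax'
      (g₁ := _) (g₂ := _)
      (by filter_upwards [hl1.first, hl2.first] with s h1 h2
          using h1.fun_add (h2.const_mul (c / 2)))
      (hl1.second.fun_add (hl2.second.const_mul (c / 2)))
    simp only [zero_smul, add_zero, hθ, hXX, hXν, hWein, lorentz_smul_right, hXT, neg_neg,
      lorentz_comm (fderiv ℝ X ξ (T b)) (X ξ), hG, if_true,
      lorentz_comm (fderiv ℝ (fderiv ℝ X) ξ (T b) (T b)) (X ξ), zero_add] at hfin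
    obtain ⟨hf1, hf2⟩ := hfin
    refine ⟨?_, ?_⟩
    · field_simp at hf1
      linarith
    · rw [hWein, lorentz_smul_right, hG, if_pos rfl]
      refine le_of_eq_of_le ?_ hf2
      ring
  have hor : ∀ b, Z b = 0 ∨ u * lam b = -(c * W) := fun b => by
    rcases mul_eq_zero.1 (cond b).1 with h1 | h1
    · right; linarith
    · left; exact h1
  refine ⟨hor a, ?_⟩
  -- All λ_b with Z_b ≠ 0 coincide, so z is itself a principal direction. This exchanges ⟨D²X(T_a,
  -- T_a), X_z⟩, coming from ln |X|, for the term with N_z in the derivative of h_aa.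
  have hNz : u • fderiv ℝ N ξ z = (-(c * W)) • fderiv ℝ X ξ z := by
    rw [hz, map_sum, map_sum, Finset.smul_sum, Finset.smul_sum]
    refine Finset.sum_congr rfl fun b _ => ?_
    rw [map_smul, map_smul, hWein]
    rcases hor b with h0 | h0
    · simp [h0]
    · rw [← h0]; module
  have hNz' : u * lorentz (fderiv ℝ (fderiv ℝ X) ξ (T a) (T a)) (fderiv ℝ N ξ z) =
      -(c * W) * lorentz (fderiv ℝ (fderiv ℝ X) ξ (T a) (T a)) (fderiv ℝ X ξ z) := by
    rw [← lorentz_smul_right, hNz, lorentz_smul_right]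
  have ht := (h.tangent_deriv (T a) z).2
  rw [hWein, lorentz_smul_right] at ht
  have hsymm : fderiv ℝ (fderiv ℝ X) ξ z (T a) = fderiv ℝ (fderiv ℝ X) ξ (T a) z :=
    ((h.contDiffAt.of_le (by norm_num : (2 : WithTop ℕ∞) ≤ 3)).isSymmSndFDerivAt (by simp)) z (T a)
  have hnn := (h.normal_deriv (T a)).2
  rw [hWein, lorentz_smul_left, lorentz_smul_right, hG, if_pos rfl] at hnn
  have hHa := hH a a
  rw [if_pos rfl] at hHa
  obtain ⟨c1, c2⟩ := cond a
  rw [hWein, lorentz_smul_right, hG, if_pos rfl] at c2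
  have e1 : lorentz (X ξ) (fderiv ℝ (fderiv ℝ N) ξ (T a) (T a)) =
      lorentz (fderiv ℝ X ξ z) (fderiv ℝ (fderiv ℝ N) ξ (T a) (T a)) +
        u * W * lorentz (N ξ) (fderiv ℝ (fderiv ℝ N) ξ (T a) (T a)) := by
    conv_lhs => rw [hX, lorentz_add_left, lorentz_smul_left]
  have e2 : lorentz (X ξ) (fderiv ℝ (fderiv ℝ X) ξ (T a) (T a)) =
      lorentz (fderiv ℝ (fderiv ℝ X) ξ (T a) (T a)) (fderiv ℝ X ξ z) +
        u * W * lorentz (fderiv ℝ (fderiv ℝ X) ξ (T a) (T a)) (N ξ) := by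
    rw [lorentz_comm]
    conv_lhs => rw [hX, lorentz_add_right, lorentz_smul_right]
  rw [e1, e2] at c2
  rw [hsymm]
  generalize lorentz (fderiv ℝ X ξ z) (fderiv ℝ (fderiv ℝ N) ξ (T a) (T a)) = y₁ at *
  generalize lorentz (N ξ) (fderiv ℝ (fderiv ℝ N) ξ (T a) (T a)) = y₂ at *
  generalize lorentz (fderiv ℝ (fderiv ℝ X) ξ (T a) (T a)) (fderiv ℝ X ξ z) = y₃ at *
  generalize lorentz (fderiv ℝ (fderiv ℝ X) ξ (T a) (T a)) (N ξ) = y₄ at *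
  generalize lorentz (fderiv ℝ (fderiv ℝ X) ξ (T a) (T a)) (fderiv ℝ N ξ z) = y₅ at *
  generalize lorentz (fderiv ℝ (fderiv ℝ (fderiv ℝ X)) ξ z (T a) (T a)) (N ξ) = y₆ at *
  generalize lorentz (fderiv ℝ (fderiv ℝ X) ξ (T a) z) (fderiv ℝ X ξ (T a)) = y₇ at *
  obtain rfl : y₄ = -lam a := by linarith
  obtain rfl : y₂ = -(lam a * (lam a * 1)) := hnn
  obtain rfl : y₁ = -y₆ - 2 * (lam a * y₇) := by linarith
  have e5 : y₅ = -(c * W) * y₃ / u := by rw [eq_div_iff hu.ne']; linarith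
  rw [e5]
  have hsq : (lam a * Z a / (u * W)) ^ 2 = (c * Z a / u ^ 2) ^ 2 := by
    rcases hor a with h0 | h0
    · simp [h0]
    · have : lam a = -(c * W) / u := by rw [eq_div_iff hu.ne']; linarith
      rw [this]; field_simp
  rw [hsq] at c2
  -- Multiplying by u² brings the second-order condition to the stated normalization.
  have hmul := mul_nonpos_of_nonneg_of_nonpos (sq_nonneg u) c2
  refine le_of_eq_of_le ?_ hmul
  field_simp
  ring

end IsHypersurfaceAt

end HypGraph

/-! ### The hyperbolic metric in the global chart -/

namespace HypGraph

open Filter Topology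

section Chart

variable {n : ℕ}

@[simp] theorem coord_point (ξ : EuclideanSpace ℝ (Fin n)) : coord (point ξ) = ξ := rfl

@[simp] theorem point_val (ξ : EuclideanSpace ℝ (Fin n)) : (point ξ).1 = position ξ := rfl

theorem position_coord (x : Hyp n) : position (coord x) = x.1 := by
  have h1 := x.2.1
  rw [lorentz_eq_inner, real_inner_self_eq_norm_sq] at h1
  refine Prod.ext rfl ?_
  change √(1 + ‖x.1.1‖ ^ 2) = x.1.2
  rw [show 1 + ‖x.1.1‖ ^ 2 = x.1.2 ^ 2 by linarith, Real.sqrt_sq x.2.2.le]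

@[simp] theorem point_coord (x : Hyp n) : point (coord x) = x := Subtype.ext (position_coord x)

theorem contDiff_position {m : WithTop ℕ∞} :
    ContDiff ℝ m (position : EuclideanSpace ℝ (Fin n) → Mink n) := by
  refine contDiff_id.prodMk ?_
  exact (contDiff_const.add (contDiff_norm_sq ℝ)).sqrt fun ξ => by positivity

theorem fderiv_position (ξ w : EuclideanSpace ℝ (Fin n)) :
    fderiv ℝ position ξ w = (w, inner ℝ ξ w / √(1 + ‖ξ‖ ^ 2)) := by
  have h : HasFDerivAt (fun ξ : EuclideanSpace ℝ (Fin n) => 1 + ‖ξ‖ ^ 2) (2 • innerSL ℝ ξ) ξ :=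
    ((hasStrictFDerivAt_norm_sq ξ).hasFDerivAt).const_add 1
  have h2 : HasFDerivAt (position : EuclideanSpace ℝ (Fin n) → Mink n) _ ξ :=
    (hasFDerivAt_id ξ).prodMk (h.sqrt (by positivity))
  rw [h2.fderiv]
  simp only [ContinuousLinearMap.prod_apply, ContinuousLinearMap.id_apply, smul_apply,
    innerSL_apply_apply, smul_eq_mul, nsmul_eq_mul]
  congr 1
  push_cast
  field_simp

/-- The hyperbolic metric on coordinate vectors. -/
noncomputable def hypInner (ξ a b : EuclideanSpace ℝ (Fin n)) : ℝ :=
  inner ℝ a b - inner ℝ ξ a * inner ℝ ξ b / (1 + ‖ξ‖ ^ 2)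

theorem lorentz_fderiv_position (ξ a b : EuclideanSpace ℝ (Fin n)) :
    lorentz (fderiv ℝ position ξ a) (fderiv ℝ position ξ b) = hypInner ξ a b := by
  have h : (0 : ℝ) < 1 + ‖ξ‖ ^ 2 := by positivity
  rw [fderiv_position, fderiv_position, lorentz_eq_inner, hypInner, div_mul_div_comm,
    Real.mul_self_sqrt h.le]

theorem lorentz_position_fderiv (ξ a : EuclideanSpace ℝ (Fin n)) :
    lorentz (position ξ) (fderiv ℝ position ξ a) = 0 := by
  have h : (0 : ℝ) < √(1 + ‖ξ‖ ^ 2) := Real.sqrt_pos.2 (by positivity)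
  rw [fderiv_position, lorentz_eq_inner, position]
  field_simp
  ring

theorem lorentz_position_self (ξ : EuclideanSpace ℝ (Fin n)) :
    lorentz (position ξ) (position ξ) = -1 := (position_mem ξ).1

theorem hypInner_self_pos (ξ : EuclideanSpace ℝ (Fin n)) {w : EuclideanSpace ℝ (Fin n)}
    (hw : w ≠ 0) : 0 < hypInner ξ w w := by
  have h1 : inner ℝ ξ w * inner ℝ ξ w ≤ ‖ξ‖ ^ 2 * ‖w‖ ^ 2 := by
    have := real_inner_mul_inner_self_le ξ w
    rw [real_inner_self_eq_norm_sq, real_inner_self_eq_norm_sq] at this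
    exact this
  have h2 : 0 < ‖w‖ := norm_pos_iff.2 hw
  rw [hypInner, sub_pos, real_inner_self_eq_norm_sq, div_lt_iff₀ (by positivity)]
  nlinarith

theorem hypInner_self_nonneg (ξ w : EuclideanSpace ℝ (Fin n)) : 0 ≤ hypInner ξ w w := by
  by_cases hw : w = 0
  · simp [hypInner, hw]
  · exact (hypInner_self_pos ξ hw).le

/-- The vector representing a covector for the Euclidean product of the chart. -/
noncomputable def dualVec (p : EuclideanSpace ℝ (Fin n) →L[ℝ] ℝ) : EuclideanSpace ℝ (Fin n) :=
  (InnerProductSpace.toDual ℝ (EuclideanSpace ℝ (Fin n))).symm p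

theorem inner_dualVec (p : EuclideanSpace ℝ (Fin n) →L[ℝ] ℝ) (w : EuclideanSpace ℝ (Fin n)) :
    inner ℝ (dualVec p) w = p w := InnerProductSpace.toDual_symm_apply

theorem apply_basisVec (p : EuclideanSpace ℝ (Fin n) →L[ℝ] ℝ) (i : Fin n) :
    p (basisVec i) = dualVec p i := by
  rw [← inner_dualVec, basisVec, EuclideanSpace.inner_single_right]
  simp

theorem contDiff_dualVec {m : WithTop ℕ∞} : ContDiff ℝ m (dualVec (n := n)) :=
  (InnerProductSpace.toDual ℝ (EuclideanSpace ℝ (Fin n))).symm.contDiff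

/-- The components of the hyperbolic gradient dual to a covector. -/
noncomputable def gradCoord (ξ : EuclideanSpace ℝ (Fin n))
    (p : EuclideanSpace ℝ (Fin n) →L[ℝ] ℝ) : EuclideanSpace ℝ (Fin n) :=
  dualVec p + inner ℝ ξ (dualVec p) • ξ

theorem hypInner_gradCoord (ξ w : EuclideanSpace ℝ (Fin n))
    (p : EuclideanSpace ℝ (Fin n) →L[ℝ] ℝ) : hypInner ξ (gradCoord ξ p) w = p w := by
  have h : (1 : ℝ) + ‖ξ‖ ^ 2 ≠ 0 := by positivity
  rw [hypInner, gradCoord, inner_add_left, inner_add_right, inner_smul_left, inner_smul_right,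
    inner_dualVec, real_inner_self_eq_norm_sq]
  simp only [RCLike.conj_to_real]
  field_simp
  ring

/-- The metric is the rank-one perturbation I - ξξᵀ/(1 + |ξ|²), with inverse I + ξξᵀ. -/
theorem hypMetric_inv (x : Hyp n) (i j : Fin n) :
    (hypMetric x)⁻¹ i j = (if i = j then 1 else 0) + coord x i * coord x j := by
  have h : (1 : ℝ) + ‖coord x‖ ^ 2 ≠ 0 := by positivity
  have hm : ∀ i j, hypMetric x i j =
      (if i = j then 1 else 0) - coord x i * coord x j / (1 + ‖coord x‖ ^ 2) := by
    intro i j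
    change lorentz (fderiv ℝ position (coord x) (basisVec i))
      (fderiv ℝ position (coord x) (basisVec j)) = _
    rw [lorentz_fderiv_position, hypInner]
    simp [basisVec, EuclideanSpace.inner_single_right, eq_comm]
  have hs : ∑ k, coord x k * coord x k = ‖coord x‖ ^ 2 := by
    rw [EuclideanSpace.real_norm_sq_eq]; simp only [pow_two]
  have hinv : (hypMetric x)⁻¹ =
      Matrix.of fun i j => (if i = j then 1 else 0) + coord x i * coord x j := by
    refine Matrix.inv_eq_right_inv ?_
    ext i j
    rw [Matrix.mul_apply, Matrix.one_apply]
    simp only [hm, Matrix.of_apply]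
    have : ∀ k, ((if i = k then (1 : ℝ) else 0) - coord x i * coord x k / (1 + ‖coord x‖ ^ 2)) *
        ((if k = j then 1 else 0) + coord x k * coord x j) =
        (if i = k then (if k = j then (1 : ℝ) else 0) + coord x k * coord x j else 0)
        - (if k = j then coord x i * coord x k / (1 + ‖coord x‖ ^ 2) else 0)
        - coord x i * coord x j / (1 + ‖coord x‖ ^ 2) * (coord x k * coord x k) := by
      intro k
      split_ifs <;> ring
    simp only [this, Finset.sum_sub_distrib, ← Finset.mul_sum, hs, Finset.sum_ite_eq,
      Finset.sum_ite_eq', Finset.mem_univ, if_true]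
    field_simp
    ring
  rw [hinv, Matrix.of_apply]

theorem sum_smul_basisVec (w : EuclideanSpace ℝ (Fin n)) : ∑ i, w i • basisVec i = w := by
  ext j
  simp [basisVec, Finset.sum_apply, Pi.single_apply]

theorem gradCoord_apply (x : Hyp n) (p : EuclideanSpace ℝ (Fin n) →L[ℝ] ℝ) (j : Fin n) :
    gradCoord (coord x) p j = ∑ i, (hypMetric x)⁻¹ i j * p (basisVec i) := by
  simp only [hypMetric_inv, apply_basisVec, add_mul, Finset.sum_add_distrib, ite_mul, one_mul,
    zero_mul, Finset.sum_ite_eq', Finset.mem_univ, if_true]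
  simp only [gradCoord, PiLp.add_apply, PiLp.smul_apply, smul_eq_mul, PiLp.inner_apply,
    Finset.sum_mul]
  congr 1
  refine Finset.sum_congr rfl fun i _ => ?_
  simp
  ring

theorem gradVec_eq (x : Hyp n) (p : EuclideanSpace ℝ (Fin n) →L[ℝ] ℝ) :
    gradVec x p = fderiv ℝ position (coord x) (gradCoord (coord x) p) := by
  conv_rhs => rw [← sum_smul_basisVec (gradCoord (coord x) p)]
  rw [map_sum, gradVec, Finset.sum_comm]
  refine Finset.sum_congr rfl fun j _ => ?_
  rw [map_smul, gradCoord_apply, Finset.sum_smul]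
  rfl

theorem hypInner_gradCoord_self (ξ : EuclideanSpace ℝ (Fin n))
    (p : EuclideanSpace ℝ (Fin n) →L[ℝ] ℝ) :
    hypInner ξ (gradCoord ξ p) (gradCoord ξ p) = ‖dualVec p‖ ^ 2 + inner ℝ ξ (dualVec p) ^ 2 := by
  rw [hypInner_gradCoord, ← inner_dualVec, gradCoord, inner_add_right, inner_smul_right,
    real_inner_self_eq_norm_sq, real_inner_comm]
  ring

theorem covecNorm_eq (x : Hyp n) (p : EuclideanSpace ℝ (Fin n) →L[ℝ] ℝ) :
    covecNorm x p = √(‖dualVec p‖ ^ 2 + inner ℝ (coord x) (dualVec p) ^ 2) := by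
  rw [covecNorm, ← hypInner_gradCoord_self, hypInner_gradCoord]
  congr 1
  conv_rhs => rw [← sum_smul_basisVec (gradCoord (coord x) p)]
  rw [map_sum, Finset.sum_comm]
  refine Finset.sum_congr rfl fun j _ => ?_
  rw [map_smul, gradCoord_apply, smul_eq_mul, Finset.sum_mul]

theorem covecNorm_sq (x : Hyp n) (p : EuclideanSpace ℝ (Fin n) →L[ℝ] ℝ) :
    covecNorm x p ^ 2 = hypInner (coord x) (gradCoord (coord x) p) (gradCoord (coord x) p) := by
  rw [covecNorm_eq, Real.sq_sqrt (by positivity), hypInner_gradCoord_self]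

theorem covecNorm_nonneg (x : Hyp n) (p : EuclideanSpace ℝ (Fin n) →L[ℝ] ℝ) :
    0 ≤ covecNorm x p := Real.sqrt_nonneg _

/-- Cauchy–Schwarz for σ, from σ ≥ 0 on the vector σ(w, w)g - p(w)w, where g is the gradient dual to
p. -/
theorem sq_apply_le (x : Hyp n) (p : EuclideanSpace ℝ (Fin n) →L[ℝ] ℝ)
    (w : EuclideanSpace ℝ (Fin n)) :
    p w ^ 2 ≤ covecNorm x p ^ 2 * hypInner (coord x) w w := by
  rw [covecNorm_sq]
  set g := gradCoord (coord x) p with hg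
  have hgw : hypInner (coord x) g w = p w := hypInner_gradCoord _ _ _
  by_cases hw : w = 0
  · subst hw; simp [hypInner]
  have hpos := hypInner_self_pos (coord x) hw
  have h := hypInner_self_nonneg (coord x) (hypInner (coord x) w w • g - p w • w)
  have e : hypInner (coord x) (hypInner (coord x) w w • g - p w • w)
      (hypInner (coord x) w w • g - p w • w) = hypInner (coord x) w w *
        (hypInner (coord x) g g * hypInner (coord x) w w - p w ^ 2) := by
    rw [← hgw]
    simp only [hypInner, inner_sub_left, inner_sub_right, inner_smul_left, inner_smul_right,
      RCLike.conj_to_real, real_inner_comm g w]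
    ring
  rw [e] at h
  have := nonneg_of_mul_nonneg_right h hpos
  linarith

theorem abs_apply_le (x : Hyp n) (p : EuclideanSpace ℝ (Fin n) →L[ℝ] ℝ)
    (w : EuclideanSpace ℝ (Fin n)) :
    |p w| ≤ covecNorm x p * √(hypInner (coord x) w w) := by
  refine abs_le_of_sq_le_sq ?_ (mul_nonneg (covecNorm_nonneg _ _) (Real.sqrt_nonneg _))
  rw [mul_pow, Real.sq_sqrt (hypInner_self_nonneg _ _)]
  exact sq_apply_le x p w

end Chart

end HypGraph

/-! ### The spacelike graph as a hypersurface -/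

namespace HypGraph

open Filter Topology

section Graph

variable {n : ℕ} {M : Set (Hyp n)} {u : Hyp n → ℝ} {du : Hyp n → EuclideanSpace ℝ (Fin n) →L[ℝ] ℝ}

theorem continuous_point : Continuous (point : EuclideanSpace ℝ (Fin n) → Hyp n) :=
  Continuous.subtype_mk (contDiff_position (m := 0)).continuous _

theorem continuous_coord : Continuous (coord : Hyp n → EuclideanSpace ℝ (Fin n)) :=
  continuous_fst.comp continuous_subtype_val

/-- The pointwise data of a spacelike graph at `x`: `u > 0` and `|Du| < u`. -/
structure IsSpacelikeAt (u : Hyp n → ℝ) (du : Hyp n → EuclideanSpace ℝ (Fin n) →L[ℝ] ℝ)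
    (x : Hyp n) : Prop where
  pos : 0 < u x
  lt_one : covecNorm x (du x) / u x < 1

namespace IsSpacelikeAt

variable {x : Hyp n} (h : IsSpacelikeAt u du x)

theorem lorentz_smul_normal : lorentz (u x • x.1) (normal u du x) = -(u x * gradFun u du x) := by
  rw [normal, gradVec_eq, ← position_coord x, lorentz_smul_left, lorentz_smul_right,
    lorentz_add_right, lorentz_smul_right, lorentz_position_self, lorentz_position_fderiv, gradFun]
  ring

include h

theorem one_sub_pos : 0 < 1 - (covecNorm x (du x) / u x) ^ 2 := by
  have h0 : 0 ≤ covecNorm x (du x) / u x := div_nonneg (covecNorm_nonneg _ _) h.pos.le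
  nlinarith [h.lt_one]

theorem gradFun_pos : 0 < gradFun u du x :=
  one_div_pos.2 (Real.sqrt_pos.2 h.one_sub_pos)

theorem gradFun_sq_mul : gradFun u du x ^ 2 * (1 - (covecNorm x (du x) / u x) ^ 2) = 1 := by
  rw [gradFun, tilt, div_pow, Real.sq_sqrt h.one_sub_pos.le, one_pow, one_div,
    inv_mul_cancel₀ h.one_sub_pos.ne']

theorem one_le_gradFun : 1 ≤ gradFun u du x := by
  have h1 := h.gradFun_sq_mul
  have h2 := h.gradFun_pos
  have h3 := sq_nonneg (gradFun u du x * (covecNorm x (du x) / u x))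
  nlinarith

theorem covecNorm_sq_eq :
    gradFun u du x ^ 2 * covecNorm x (du x) ^ 2 = u x ^ 2 * (gradFun u du x ^ 2 - 1) := by
  have h1 := h.gradFun_sq_mul
  have hu := h.pos.ne'
  field_simp at h1
  linarith

theorem lorentz_normal_self : lorentz (normal u du x) (normal u du x) = -1 := by
  have h1 := h.gradFun_sq_mul
  have hu := h.pos.ne'
  rw [normal, gradVec_eq, ← position_coord x, lorentz_smul_left, lorentz_smul_right,
    lorentz_add_left, lorentz_add_right, lorentz_add_right, lorentz_smul_left, lorentz_smul_left,
    lorentz_smul_right, lorentz_smul_right, lorentz_position_self, lorentz_position_fderiv,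
    lorentz_comm _ (position _), lorentz_position_fderiv, lorentz_fderiv_position, ← covecNorm_sq]
  change gradFun u du x * (gradFun u du x * _) = _
  rw [div_pow] at h1
  linear_combination -h1

theorem lorentz_tangent_normal (w : EuclideanSpace ℝ (Fin n)) :
    lorentz (du x w • position (coord x) + u x • fderiv ℝ position (coord x) w)
      (normal u du x) = 0 := by
  have hu := h.pos.ne'
  rw [normal, gradVec_eq, ← position_coord x, lorentz_smul_right, lorentz_add_left,
    lorentz_smul_left, lorentz_smul_left, lorentz_add_right, lorentz_add_right, lorentz_smul_right,
    lorentz_smul_right, lorentz_position_self, lorentz_position_fderiv,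
    lorentz_comm _ (position _), lorentz_position_fderiv, lorentz_fderiv_position,
    hypInner, real_inner_comm, mul_comm (inner ℝ (coord x) w), ← hypInner, hypInner_gradCoord]
  field_simp
  ring

/-- The tangential part of X is the image of z = -(𝒲²/u) Du: then du(z) = -u(𝒲² - 1), and adding u𝒲ν
= u𝒲²x + 𝒲²Du leaves ux. -/
theorem position_decomp : u x • position (coord x) =
    (du x (-(gradFun u du x ^ 2 / u x) • gradCoord (coord x) (du x)) • position (coord x) +
      u x • fderiv ℝ position (coord x) (-(gradFun u du x ^ 2 / u x) • gradCoord (coord x) (du x)))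
      + (u x * gradFun u du x) • normal u du x := by
  have hu := h.pos.ne'
  have h1 := h.covecNorm_sq_eq
  have h2 : du x (gradCoord (coord x) (du x)) = covecNorm x (du x) ^ 2 := by
    rw [covecNorm_sq, hypInner_gradCoord]
  have h3 : normal u du x = gradFun u du x • (position (coord x) +
      (1 / u x) • fderiv ℝ position (coord x) (gradCoord (coord x) (du x))) := by
    rw [normal, gradVec_eq, position_coord, gradFun]
  rw [h3, map_smul, map_smul, h2, smul_eq_mul]
  have e : -(gradFun u du x ^ 2 / u x) * covecNorm x (du x) ^ 2 =
      -(u x * (gradFun u du x ^ 2 - 1)) := by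
    field_simp
    linear_combination -h1
  rw [e]
  match_scalars
  · ring
  · field_simp; ring

/-- The hyperbolic length 𝒲√(𝒲² - 1) of z is the factor multiplying B when Ψ is differentiated along
z. -/
theorem hypInner_direction : hypInner (coord x)
    (-(gradFun u du x ^ 2 / u x) • gradCoord (coord x) (du x))
    (-(gradFun u du x ^ 2 / u x) • gradCoord (coord x) (du x)) =
    gradFun u du x ^ 2 * (gradFun u du x ^ 2 - 1) := by
  have hu := h.pos.ne'
  have h1 := h.covecNorm_sq_eq
  have : ∀ (c : ℝ) (g : EuclideanSpace ℝ (Fin n)),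
      hypInner (coord x) (c • g) (c • g) = c ^ 2 * hypInner (coord x) g g := by
    intro c g
    simp only [hypInner, inner_smul_left, inner_smul_right, RCLike.conj_to_real]
    ring
  rw [this, ← covecNorm_sq]
  field_simp
  linear_combination gradFun u du x ^ 2 * h1

/-- The induced metric is u²σ(w, w) - du(w)², positive by Cauchy–Schwarz and |Du| < u. -/
theorem lorentz_tangent_self_pos {w : EuclideanSpace ℝ (Fin n)} (hw : w ≠ 0) :
    0 < lorentz (du x w • position (coord x) + u x • fderiv ℝ position (coord x) w)
      (du x w • position (coord x) + u x • fderiv ℝ position (coord x) w) := by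
  rw [lorentz_add_left, lorentz_add_right, lorentz_add_right, lorentz_smul_left, lorentz_smul_left,
    lorentz_smul_left, lorentz_smul_left, lorentz_smul_right, lorentz_smul_right,
    lorentz_smul_right, lorentz_smul_right, lorentz_position_self, lorentz_position_fderiv,
    lorentz_comm _ (position _), lorentz_position_fderiv, lorentz_fderiv_position]
  have h1 := sq_apply_le x (du x) w
  have h2 := hypInner_self_pos (coord x) hw
  have h3 : covecNorm x (du x) < u x := (div_lt_one h.pos).1 h.lt_one
  have h4 := covecNorm_nonneg x (du x)
  have h5 : covecNorm x (du x) ^ 2 < u x ^ 2 := by nlinarith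
  nlinarith [mul_lt_mul_of_pos_right h5 h2]

end IsSpacelikeAt

theorem isOpen_preimage_point (hM : IsOpen M) : IsOpen (point ⁻¹' M) := hM.preimage continuous_point

theorem eventually_point_mem (hM : IsOpen M) {ξ : EuclideanSpace ℝ (Fin n)} (hξ : point ξ ∈ M) :
    ∀ᶠ η in 𝓝 ξ, point η ∈ M := (isOpen_preimage_point hM).mem_nhds hξ

namespace HasDifferential

variable (hd : HasDifferential M u du) (hM : IsOpen M)

include hd

theorem fderiv_eq {ξ : EuclideanSpace ℝ (Fin n)} (hξ : point ξ ∈ M) :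
    fderiv ℝ (fun ξ => u (point ξ)) ξ = du (point ξ) :=
  (hd.hasFDerivAt _ hξ).fderiv

theorem hasFDerivAt_graphMap {ξ : EuclideanSpace ℝ (Fin n)} (hξ : point ξ ∈ M)
    (w : EuclideanSpace ℝ (Fin n)) : fderiv ℝ (graphMap u) ξ w =
      du (point ξ) w • position ξ + u (point ξ) • fderiv ℝ position ξ w := by
  have h1 := hd.hasFDerivAt _ hξ
  rw [coord_point] at h1
  have h2 : HasFDerivAt (position : EuclideanSpace ℝ (Fin n) → Mink n) (fderiv ℝ position ξ) ξ :=
    (contDiff_position (m := 1)).differentiable (by simp) ξ |>.hasFDerivAt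
  rw [show graphMap u = fun ξ => u (point ξ) • position ξ from rfl, (h1.fun_smul h2).fderiv]
  simp [add_comm]

include hM

theorem contDiffAt {ξ : EuclideanSpace ℝ (Fin n)} (hξ : point ξ ∈ M) :
    ContDiffAt ℝ 3 (fun ξ => u (point ξ)) ξ :=
  hd.contDiffOn.contDiffAt ((isOpen_preimage_point hM).mem_nhds hξ)

theorem contDiffAt_normal {ξ : EuclideanSpace ℝ (Fin n)} (hξ : point ξ ∈ M)
    (hs : IsSpacelikeAt u du (point ξ)) :
    ContDiffAt ℝ 2 (fun ξ => normal u du (point ξ)) ξ := by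
  have hU : ContDiffAt ℝ 2 (fun ξ => u (point ξ)) ξ := (hd.contDiffAt hM hξ).of_le (by norm_num)
  have hU0 : u (point ξ) ≠ 0 := hs.pos.ne'
  have hdu : ContDiffAt ℝ 2 (fun ξ => du (point ξ)) ξ := by
    refine ((hd.contDiffAt hM hξ).fderiv_right (m := 2) (by norm_num)).congr_of_eventuallyEq ?_
    filter_upwards [eventually_point_mem hM hξ] with η hη using (hd.fderiv_eq hη).symm
  have hP : ContDiffAt ℝ 2 (fun ξ => dualVec (du (point ξ))) ξ :=
    contDiff_dualVec.contDiffAt.comp ξ hdu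
  have hiP : ContDiffAt ℝ 2 (fun ξ => inner ℝ ξ (dualVec (du (point ξ)))) ξ :=
    contDiffAt_id.inner ℝ hP
  have hg : ContDiffAt ℝ 2 (fun ξ => gradCoord ξ (du (point ξ))) ξ :=
    hP.add (hiP.smul contDiffAt_id)
  have htilt : ContDiffAt ℝ 2 (fun ξ => tilt u du (point ξ)) ξ := by
    have h1 : ∀ ξ : EuclideanSpace ℝ (Fin n), tilt u du (point ξ) =
        √(1 - (‖dualVec (du (point ξ))‖ ^ 2 + inner ℝ ξ (dualVec (du (point ξ))) ^ 2) /
          u (point ξ) ^ 2) := fun ξ => by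
      rw [tilt, div_pow, covecNorm_eq, Real.sq_sqrt (by positivity), coord_point]
    have h2 := hs.one_sub_pos
    rw [div_pow, covecNorm_eq, Real.sq_sqrt (by positivity), coord_point] at h2
    simp only [h1]
    exact (contDiffAt_const.sub (((hP.norm_sq ℝ).add (hiP.pow 2)).div (hU.pow 2)
      (pow_ne_zero 2 hU0))).sqrt h2.ne'
  have ht0 : tilt u du (point ξ) ≠ 0 := (Real.sqrt_pos.2 hs.one_sub_pos).ne'
  have hq : ContDiffAt ℝ 2 (fun ξ : EuclideanSpace ℝ (Fin n) => √(1 + ‖ξ‖ ^ 2)) ξ :=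
    (contDiffAt_const.add (contDiffAt_id.norm_sq ℝ)).sqrt (by positivity)
  have hq0 : √(1 + ‖ξ‖ ^ 2) ≠ 0 := (Real.sqrt_pos.2 (by positivity)).ne'
  have hpos : ContDiffAt ℝ 2 (position : EuclideanSpace ℝ (Fin n) → Mink n) ξ :=
    contDiff_position.contDiffAt
  have h3 : (fun ξ => normal u du (point ξ)) = fun ξ => (1 / tilt u du (point ξ)) •
      (position ξ + (1 / u (point ξ)) • ((gradCoord ξ (du (point ξ)),
        inner ℝ ξ (gradCoord ξ (du (point ξ))) / √(1 + ‖ξ‖ ^ 2)) : Mink n)) := by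
    funext ξ
    rw [normal, gradVec_eq, coord_point, point_val, fderiv_position]
  rw [h3]
  exact (contDiffAt_const.div htilt ht0).smul (hpos.add ((contDiffAt_const.div hU hU0).smul
    (hg.prodMk ((contDiffAt_id.inner ℝ hg).div hq hq0))))

theorem isHypersurfaceAt (hs : ∀ x ∈ M, IsSpacelikeAt u du x) {ξ : EuclideanSpace ℝ (Fin n)}
    (hξ : point ξ ∈ M) :
    IsHypersurfaceAt (graphMap u) (fun ξ => normal u du (point ξ)) ξ where
  contDiffAt := (hd.contDiffAt hM hξ).smul contDiff_position.contDiffAt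
  contDiffAt_normal := hd.contDiffAt_normal hM hξ (hs _ hξ)
  unit := by
    filter_upwards [eventually_point_mem hM hξ] with η hη using (hs _ hη).lorentz_normal_self
  orthogonal := by
    filter_upwards [eventually_point_mem hM hξ] with η hη w
    rw [hd.hasFDerivAt_graphMap hη]
    exact (hs _ hη).lorentz_tangent_normal w

end HasDifferential

end Graph

end HypGraph

/-! ### Principal frames of the graph and its curvatures as determinants -/

namespace HypGraph

open Filter Topology

section Pullback

variable {n : ℕ}

/-- The vector with the components of the `a`-th column of `P`. -/
noncomputable def colVec (P : Matrix (Fin n) (Fin n) ℝ) (a : Fin n) : EuclideanSpace ℝ (Fin n) :=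
  ∑ i, P i a • basisVec i

theorem pullback_apply (β : EuclideanSpace ℝ (Fin n) →ₗ[ℝ] EuclideanSpace ℝ (Fin n) →ₗ[ℝ] ℝ)
    (P : Matrix (Fin n) (Fin n) ℝ) (a b : Fin n) :
    (P.transpose * Matrix.of (fun i j => β (basisVec i) (basisVec j)) * P) a b =
      β (colVec P a) (colVec P b) := by
  simp only [colVec, map_sum, map_smul, LinearMap.sum_apply, LinearMap.smul_apply, smul_eq_mul,
    Matrix.mul_apply, Matrix.transpose_apply, Matrix.of_apply, Finset.sum_mul, Finset.mul_sum]
  refine Finset.sum_congr rfl fun j _ => Finset.sum_congr rfl fun i _ => by ring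

theorem exists_coeff_colVec {P : Matrix (Fin n) (Fin n) ℝ} (hP : IsUnit P.det)
    (z : EuclideanSpace ℝ (Fin n)) : ∃ Z : Fin n → ℝ, z = ∑ a, Z a • colVec P a := by
  refine ⟨P⁻¹.mulVec z, ?_⟩
  conv_lhs => rw [← sum_smul_basisVec z]
  simp only [colVec, Finset.smul_sum, smul_smul]
  rw [Finset.sum_comm]
  refine Finset.sum_congr rfl fun i _ => ?_
  rw [← Finset.sum_smul]
  congr 1
  have : P.mulVec (P⁻¹.mulVec z) i = z i := by
    rw [Matrix.mulVec_mulVec, Matrix.mul_nonsing_inv _ hP, Matrix.one_mulVec]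
  rw [← this, Matrix.mulVec, dotProduct]
  exact Finset.sum_congr rfl fun a _ => mul_comm _ _

end Pullback

theorem differentiableAt_det {n : ℕ} {E : Type*} [NormedAddCommGroup E] [NormedSpace ℝ E]
    {A : E → Matrix (Fin n) (Fin n) ℝ} {ξ : E}
    (hA : ∀ i j, DifferentiableAt ℝ (fun η => A η i j) ξ) :
    DifferentiableAt ℝ (fun η => (A η).det) ξ := by
  simp only [Matrix.det_apply, ← Int.cast_smul_eq_zsmul ℝ, smul_eq_mul, Units.smul_def]
  refine DifferentiableAt.fun_sum fun σ _ => DifferentiableAt.const_mul ?_ _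
  exact (HasFDerivAt.finsetProd fun i _ => (hA (σ i) i).hasFDerivAt).differentiableAt

section Graph

variable {n : ℕ} {M : Set (Hyp n)} {u : Hyp n → ℝ} {du : Hyp n → EuclideanSpace ℝ (Fin n) →L[ℝ] ℝ}

/-- The first fundamental form of a parametrized hypersurface as a bilinear form. -/
noncomputable def firstForm (X : EuclideanSpace ℝ (Fin n) → Mink n)
    (ξ : EuclideanSpace ℝ (Fin n)) :
    EuclideanSpace ℝ (Fin n) →ₗ[ℝ] EuclideanSpace ℝ (Fin n) →ₗ[ℝ] ℝ :=
  LinearMap.mk₂ ℝ (fun v w => lorentz (fderiv ℝ X ξ v) (fderiv ℝ X ξ w))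
    (fun _ _ _ => by rw [map_add, lorentz_add_left])
    (fun _ _ _ => by rw [map_smul, lorentz_smul_left, smul_eq_mul])
    (fun _ _ _ => by rw [map_add, lorentz_add_right])
    (fun _ _ _ => by rw [map_smul, lorentz_smul_right, smul_eq_mul])

/-- The second fundamental form of a parametrized hypersurface as a bilinear form. -/
noncomputable def shapeForm (X N : EuclideanSpace ℝ (Fin n) → Mink n)
    (ξ : EuclideanSpace ℝ (Fin n)) :
    EuclideanSpace ℝ (Fin n) →ₗ[ℝ] EuclideanSpace ℝ (Fin n) →ₗ[ℝ] ℝ :=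
  LinearMap.mk₂ ℝ (fun v w => -lorentz (fderiv ℝ (fderiv ℝ X) ξ w v) (N ξ))
    (fun _ _ _ => by rw [map_add, lorentz_add_left]; ring)
    (fun _ _ _ => by rw [map_smul, lorentz_smul_left, smul_eq_mul]; ring)
    (fun _ _ _ => by rw [map_add, add_apply, lorentz_add_left]; ring)
    (fun _ _ _ => by rw [map_smul, smul_apply, lorentz_smul_left, smul_eq_mul]; ring)

theorem graphMetric_eq (ξ : EuclideanSpace ℝ (Fin n)) : graphMetric u (point ξ) =
    Matrix.of fun i j => firstForm (graphMap u) ξ (basisVec i) (basisVec j) := rfl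

theorem HasDifferential.secondForm_eq (hd : HasDifferential M u du) (hM : IsOpen M)
    {ξ : EuclideanSpace ℝ (Fin n)} (hξ : point ξ ∈ M) : secondForm u du (point ξ) =
      Matrix.of fun i j => shapeForm (graphMap u) (fun ξ => normal u du (point ξ)) ξ
        (basisVec i) (basisVec j) := by
  ext i j
  have h1 : ContDiffAt ℝ 3 (graphMap u) ξ :=
    (hd.contDiffAt hM hξ).smul contDiff_position.contDiffAt
  have h2 : DifferentiableAt ℝ (fderiv ℝ (graphMap u)) ξ :=
    (h1.fderiv_right (m := 2) (by norm_num)).differentiableAt (by simp)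
  have h3 : fderiv ℝ (fun ξ => fderiv ℝ (graphMap u) ξ (basisVec i)) ξ (basisVec j) =
      fderiv ℝ (fderiv ℝ (graphMap u)) ξ (basisVec j) (basisVec i) := by
    rw [fderiv_clm_apply h2 (differentiableAt_const _)]
    simp
  simp only [secondForm, Matrix.of_apply, coord_point, h3]
  rfl

variable (hd : HasDifferential M u du) (hM : IsOpen M) (hs : ∀ x ∈ M, IsSpacelikeAt u du x)

include hd hs

theorem graphMetric_posDef {ξ : EuclideanSpace ℝ (Fin n)} (hξ : point ξ ∈ M) :
    (graphMetric u (point ξ)).PosDef := by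
  refine Matrix.PosDef.of_dotProduct_mulVec_pos ?_ fun w hw => ?_
  · ext i j
    simp only [Matrix.conjTranspose_apply, graphMetric, Matrix.of_apply, star_trivial]
    exact lorentz_comm _ _
  · have hw' : (WithLp.toLp 2 w : EuclideanSpace ℝ (Fin n)) ≠ 0 := fun h => hw (by
      simpa using congrArg (fun v : EuclideanSpace ℝ (Fin n) => (v : Fin n → ℝ)) h)
    have h1 := (hs _ hξ).lorentz_tangent_self_pos hw'
    rw [coord_point, ← hd.hasFDerivAt_graphMap hξ] at h1
    refine h1.trans_eq ?_
    change firstForm (graphMap u) ξ _ _ = _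
    rw [← sum_smul_basisVec (WithLp.toLp 2 w)]
    simp only [map_sum, map_smul, LinearMap.sum_apply, LinearMap.smul_apply, smul_eq_mul,
      dotProduct, Matrix.mulVec, graphMetric_eq, Matrix.of_apply, Pi.star_apply, star_trivial,
      Finset.mul_sum]
    rw [Finset.sum_comm]
    refine Finset.sum_congr rfl fun i _ => Finset.sum_congr rfl fun j _ => ?_
    ring

include hM

theorem exists_principal_frame {ξ : EuclideanSpace ℝ (Fin n)} (hξ : point ξ ∈ M) :
    ∃ (P : Matrix (Fin n) (Fin n) ℝ) (lam : Fin n → ℝ), IsUnit P.det ∧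
      P.transpose * graphMetric u (point ξ) * P = 1 ∧
      P.transpose * secondForm u du (point ξ) * P = Matrix.diagonal lam := by
  refine exists_simultaneous_diag (graphMetric_posDef hd hs hξ) ?_
  rw [hd.secondForm_eq hM hξ]
  ext i j
  simp only [Matrix.conjTranspose_apply, Matrix.of_apply, star_trivial, shapeForm,
    LinearMap.mk₂_apply]
  have h1 : ContDiffAt ℝ 2 (graphMap u) ξ :=
    ((hd.contDiffAt hM hξ).of_le (by norm_num)).smul contDiff_position.contDiffAt
  rw [(h1.isSymmSndFDerivAt (by simp)) (basisVec i) (basisVec j)]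

omit hd hM hs in
theorem weingarten_eq_elem {x : Hyp n} {P : Matrix (Fin n) (Fin n) ℝ} {lam : Fin n → ℝ}
    (hP : IsUnit P.det) (hG : P.transpose * graphMetric u x * P = 1)
    (hH : P.transpose * secondForm u du x * P = Matrix.diagonal lam) (j : ℕ) :
    weingarten u du j x = elem lam Finset.univ j := by
  rw [weingarten, principalCurvatures, charpoly_roots_of_diag hP hG hH, elem_eq_esymm]

theorem weingarten_eq_sum_det {w : ℕ → ℝ} {j : ℕ}
    (hw : ∀ p : Polynomial ℝ, p.natDegree ≤ n →
      p.coeff j = ∑ i ∈ Finset.range (n + 1), w i * p.eval (i : ℝ))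
    {ξ : EuclideanSpace ℝ (Fin n)} (hξ : point ξ ∈ M) :
    weingarten u du j (point ξ) = ∑ i ∈ Finset.range (n + 1), w i *
      ((graphMetric u (point ξ) + (i : ℝ) • secondForm u du (point ξ)).det /
        (graphMetric u (point ξ)).det) := by
  obtain ⟨P, lam, hP, hG, hH⟩ := exists_principal_frame hd hM hs hξ
  rw [weingarten_eq_elem hP hG hH, elem, hw]
  · exact Finset.sum_congr rfl fun i _ => by rw [det_add_smul_of_diag hG hH]
  · simpa using natDegree_genPoly_le lam Finset.univ

end Graph

end HypGraph

/-! ### Differentiating the equation at an interior maximum -/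

namespace HypGraph

open Filter Topology

variable {n : ℕ} {M : Set (Hyp n)} {u : Hyp n → ℝ} {du : Hyp n → EuclideanSpace ℝ (Fin n) →L[ℝ] ℝ}

theorem differentiableAt_div {E : Type*} [NormedAddCommGroup E] [NormedSpace ℝ E] {f g : E → ℝ}
    {ξ : E} (hf : DifferentiableAt ℝ f ξ) (hg : DifferentiableAt ℝ g ξ) (h : g ξ ≠ 0) :
    DifferentiableAt ℝ (fun η => f η / g η) ξ := by
  simp only [div_eq_mul_inv]
  exact hf.fun_mul (hg.fun_inv h)

namespace IsHypersurfaceAt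

variable {X N : EuclideanSpace ℝ (Fin n) → Mink n} {ξ : EuclideanSpace ℝ (Fin n)}
  (h : IsHypersurfaceAt X N ξ)

include h

theorem hasDerivAt_firstForm (z v w : EuclideanSpace ℝ (Fin n)) :
    HasDerivAt (fun t : ℝ => firstForm X (ξ + t • z) v w)
      (lorentz (fderiv ℝ (fderiv ℝ X) ξ z v) (fderiv ℝ X ξ w) +
        lorentz (fderiv ℝ X ξ v) (fderiv ℝ (fderiv ℝ X) ξ z w)) 0 := by
  have h1 := hasTwoDerivs_line (f := fderiv ℝ X) (h.contDiffAt.fderiv_right (by norm_num)) z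
  have := ((h1.clm_apply v).first.self_of_nhds).lorentz (h1.clm_apply w).first.self_of_nhds
  simp only [zero_smul, add_zero] at this
  exact this

theorem hasDerivAt_shapeForm (z v w : EuclideanSpace ℝ (Fin n)) :
    HasDerivAt (fun t : ℝ => shapeForm X N (ξ + t • z) v w)
      (-(lorentz (fderiv ℝ (fderiv ℝ (fderiv ℝ X)) ξ z w v) (N ξ) +
        lorentz (fderiv ℝ (fderiv ℝ X) ξ w v) (fderiv ℝ N ξ z))) 0 := by
  have h1 := hasTwoDerivs_line (f := fderiv ℝ X) (h.contDiffAt.fderiv_right (by norm_num)) w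
  have h2 : ContDiffAt ℝ 1 (fderiv ℝ (fderiv ℝ X)) ξ :=
    (h.contDiffAt.fderiv_right (m := 2) (by norm_num)).fderiv_right (by norm_num)
  have h3 := hasDerivAt_line (f := fderiv ℝ (fderiv ℝ X)) (ξ := ξ) (e := z) (t := 0)
    (by rw [zero_smul, add_zero]; exact h2.differentiableAt (by simp))
  have h4 := (h3.clm_apply (hasDerivAt_const (0 : ℝ) w)).clm_apply (hasDerivAt_const (0 : ℝ) v)
  have h5 := (h4.lorentz (hasTwoDerivs_line h.contDiffAt_normal z).first.self_of_nhds).fun_neg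
  exact h5.congr_deriv (by simp)

theorem differentiableAt_firstForm (v w : EuclideanSpace ℝ (Fin n)) :
    DifferentiableAt ℝ (fun η => firstForm X η v w) ξ := by
  have h1 : DifferentiableAt ℝ (fderiv ℝ X) ξ :=
    (h.contDiffAt.fderiv_right (m := 2) (by norm_num)).differentiableAt (by simp)
  have : (fun η => firstForm X η v w) =
      fun η => lorentzL n (fderiv ℝ X η v) (fderiv ℝ X η w) :=
    funext fun η => (lorentzL_apply _ _).symm
  rw [this]
  fun_prop

theorem differentiableAt_shapeForm (v w : EuclideanSpace ℝ (Fin n)) :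
    DifferentiableAt ℝ (fun η => shapeForm X N η v w) ξ := by
  have h2 : ContDiffAt ℝ 1 (fderiv ℝ (fderiv ℝ X)) ξ :=
    (h.contDiffAt.fderiv_right (m := 2) (by norm_num)).fderiv_right (by norm_num)
  have h1 := h2.differentiableAt (by simp)
  have h3 : DifferentiableAt ℝ N ξ := h.contDiffAt_normal.differentiableAt (by simp)
  have : (fun η => shapeForm X N η v w) =
      fun η => -lorentzL n (fderiv ℝ (fderiv ℝ X) η w v) (N η) :=
    funext fun η => by rw [lorentzL_apply]; rfl
  rw [this]
  fun_prop

end IsHypersurfaceAt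

section

variable (hd : HasDifferential M u du) (hM : IsOpen M) (hs : ∀ x ∈ M, IsSpacelikeAt u du x)

include hd hM hs

theorem differentiableAt_weingarten {ξ : EuclideanSpace ℝ (Fin n)} (hξ : point ξ ∈ M) (j : ℕ) :
    DifferentiableAt ℝ (fun η => weingarten u du j (point η)) ξ := by
  obtain ⟨w, hw⟩ := exists_coeff_weights n j
  have hyp := hd.isHypersurfaceAt hM hs hξ
  have hev : (fun η => weingarten u du j (point η)) =ᶠ[𝓝 ξ] fun η =>
      ∑ i ∈ Finset.range (n + 1), w i *
        ((Matrix.of (fun a b => firstForm (graphMap u) η (basisVec a) (basisVec b)) + (i : ℝ) •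
          Matrix.of (fun a b => shapeForm (graphMap u) (fun ξ => normal u du (point ξ)) η
            (basisVec a) (basisVec b))).det /
          (Matrix.of (fun a b => firstForm (graphMap u) η (basisVec a) (basisVec b))).det) := by
    filter_upwards [eventually_point_mem hM hξ] with η hη
    rw [weingarten_eq_sum_det hd hM hs hw hη, hd.secondForm_eq hM hη, graphMetric_eq]
  refine DifferentiableAt.congr_of_eventuallyEq ?_ hev
  refine DifferentiableAt.fun_sum fun i _ => DifferentiableAt.const_mul ?_ _
  refine differentiableAt_div (differentiableAt_det fun a b => ?_)
    (differentiableAt_det fun a b => ?_) ?_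
  · exact (hyp.differentiableAt_firstForm _ _).add
      ((hyp.differentiableAt_shapeForm _ _).const_mul _)
  · exact hyp.differentiableAt_firstForm _ _
  · rw [← graphMetric_eq]
    exact (graphMetric_posDef hd hs hξ).det_pos.ne'

/-- The frame P is frozen at ξ and both forms are pulled back by it along the line. The factors (det
P)² cancel in the determinant quotients, and at t = 0 the pair is (1, diag λ), so `hasDerivAt_elem`
applies. -/
theorem hasDerivAt_weingarten {ξ : EuclideanSpace ℝ (Fin n)} (hξ : point ξ ∈ M)
    {P : Matrix (Fin n) (Fin n) ℝ} {lam : Fin n → ℝ} (hP : IsUnit P.det)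
    (hG : P.transpose * graphMetric u (point ξ) * P = 1)
    (hH : P.transpose * secondForm u du (point ξ) * P = Matrix.diagonal lam)
    (z : EuclideanSpace ℝ (Fin n)) (j : ℕ) :
    HasDerivAt (fun t : ℝ => weingarten u du j (point (ξ + t • z)))
      (∑ a, elemDeriv lam Finset.univ j a *
        (-lorentz (fderiv ℝ (fderiv ℝ (fderiv ℝ (graphMap u))) ξ z (colVec P a) (colVec P a))
            (normal u du (point ξ)) -
          lorentz (fderiv ℝ (fderiv ℝ (graphMap u)) ξ (colVec P a) (colVec P a))
            (fderiv ℝ (fun ξ => normal u du (point ξ)) ξ z) -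
          lam a * (2 * lorentz (fderiv ℝ (fderiv ℝ (graphMap u)) ξ z (colVec P a))
            (fderiv ℝ (graphMap u) ξ (colVec P a))))) 0 := by
  obtain ⟨w, hw⟩ := exists_coeff_weights n j
  have hyp := hd.isHypersurfaceAt hM hs hξ
  set X := graphMap u
  set N := fun ξ => normal u du (point ξ)
  have hmem : ∀ᶠ t : ℝ in 𝓝 0, point (ξ + t • z) ∈ M :=
    (tendsto_line ξ z).eventually (eventually_point_mem hM hξ)
  have key := hasDerivAt_elem (n := n) (lam := lam) (t := 0) (j := j)
    (G := fun t => Matrix.of fun a b => firstForm X (ξ + t • z) (colVec P a) (colVec P b))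
    (H := fun t => Matrix.of fun a b => shapeForm X N (ξ + t • z) (colVec P a) (colVec P b))
    (G' := Matrix.of fun a b => lorentz (fderiv ℝ (fderiv ℝ X) ξ z (colVec P a))
        (fderiv ℝ X ξ (colVec P b)) +
        lorentz (fderiv ℝ X ξ (colVec P a)) (fderiv ℝ (fderiv ℝ X) ξ z (colVec P b)))
    (H' := Matrix.of fun a b => -(lorentz (fderiv ℝ (fderiv ℝ (fderiv ℝ X)) ξ z (colVec P b)
        (colVec P a)) (N ξ) +
        lorentz (fderiv ℝ (fderiv ℝ X) ξ (colVec P b) (colVec P a)) (fderiv ℝ N ξ z)))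
    (e := fun t : ℝ => weingarten u du j (point (ξ + t • z)))
    (fun a b => hyp.hasDerivAt_firstForm z (colVec P a) (colVec P b))
    (fun a b => hyp.hasDerivAt_shapeForm z (colVec P a) (colVec P b))
    (by
      rw [← hG, graphMetric_eq]
      ext a b
      rw [pullback_apply, zero_smul, add_zero]
      rfl)
    (by
      rw [← hH, hd.secondForm_eq hM hξ]
      ext a b
      rw [pullback_apply, zero_smul, add_zero]
      rfl) hw (by
      filter_upwards [hmem] with t ht
      rw [weingarten_eq_sum_det hd hM hs hw ht]
      refine Finset.sum_congr rfl fun i _ => ?_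
      have e1 : (Matrix.of fun a b => firstForm X (ξ + t • z) (colVec P a) (colVec P b)) =
          P.transpose * graphMetric u (point (ξ + t • z)) * P := by
        rw [graphMetric_eq]; ext a b; rw [pullback_apply]; rfl
      have e2 : (Matrix.of fun a b => shapeForm X N (ξ + t • z) (colVec P a) (colVec P b)) =
          P.transpose * secondForm u du (point (ξ + t • z)) * P := by
        rw [hd.secondForm_eq hM ht]; ext a b; rw [pullback_apply]; rfl
      have e3 : ∀ A B : Matrix (Fin n) (Fin n) ℝ, P.transpose * A * P +
          (i : ℝ) • (P.transpose * B * P) = P.transpose * (A + (i : ℝ) • B) * P := fun A B => by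
        rw [Matrix.mul_add, Matrix.add_mul, Matrix.mul_smul, Matrix.smul_mul]
      have hP0 : P.det ≠ 0 := hP.ne_zero
      rw [e1, e2, e3]
      simp only [Matrix.det_mul, Matrix.det_transpose]
      congr 1
      field_simp)
  refine key.congr_deriv (Finset.sum_congr rfl fun a _ => ?_)
  simp only [Matrix.of_apply]
  rw [lorentz_comm (fderiv ℝ X ξ (colVec P a)) (fderiv ℝ (fderiv ℝ X) ξ z (colVec P a))]
  ring

end

/-- At an interior maximum of `ln 𝒲 + S ln u` the gradient of `u` vanishes. -/
theorem gradFun_le_one_of_isLocalMax {k l : ℕ} (hlk : l + 2 ≤ k) (hd : HasDifferential M u du)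
    (hM : IsOpen M) (hs : ∀ x ∈ M, IsSpacelikeAt u du x) (hadm : IsAdmissible u du k M)
    {f : Hyp n → ℝ} (heq : ∀ x ∈ M, weingarten u du k x / weingarten u du l x = f x)
    {x : Hyp n} (hx : x ∈ M) {b B S : ℝ} (hb : 0 < b) (hbf : b ≤ f x)
    (hB : covecNorm x (fderiv ℝ (fun ξ => f (point ξ)) (coord x)) ≤ B)
    (hBS : B < S * ((k - l) * b))
    (hWS : gradFun u du x ^ 2 * (4 + 2 * ((k + 1) * n)) ≤ S - 1)
    (hmax : IsLocalMax (fun ξ => Real.log (gradFun u du (point ξ)) +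
      S * Real.log (u (point ξ))) (coord x)) : gradFun u du x ≤ 1 := by
  by_contra hW
  push Not at hW
  obtain ⟨ξ, rfl⟩ : ∃ ξ, x = point ξ := ⟨coord x, (point_coord x).symm⟩
  rw [coord_point] at hB hmax
  have hsx := hs _ hx
  obtain ⟨P, lam, hP, hG, hH⟩ := exists_principal_frame hd hM hs hx
  have hw := weingarten_eq_elem hP hG hH
  have hlam : ∀ j, j ≤ k → 0 < elem lam Finset.univ j := by
    intro j hj
    rcases Nat.eq_zero_or_pos j with rfl | h0
    · simp
    · rw [← hw]; exact hadm _ hx j h0 hj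
  set z : EuclideanSpace ℝ (Fin n) :=
    -(gradFun u du (point ξ) ^ 2 / u (point ξ)) • gradCoord ξ (du (point ξ)) with hz
  obtain ⟨Z, hZ⟩ := exists_coeff_colVec hP z
  have hyp := hd.isHypersurfaceAt hM hs hx
  have hdec := hsx.position_decomp
  rw [coord_point, ← hz, ← hd.hasFDerivAt_graphMap hx] at hdec
  have hX0 : graphMap u ξ = u (point ξ) • position ξ := rfl
  have hXX : lorentz (graphMap u ξ) (graphMap u ξ) = -u (point ξ) ^ 2 := by
    rw [hX0, lorentz_smul_left, lorentz_smul_right, lorentz_position_self]; ring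
  have hT : ∀ a b, lorentz (fderiv ℝ (graphMap u) ξ (colVec P a))
      (fderiv ℝ (graphMap u) ξ (colVec P b)) = if a = b then 1 else 0 := by
    intro a b
    have := congrFun (congrFun hG a) b
    rwa [graphMetric_eq, pullback_apply, Matrix.one_apply] at this
  have hHT : ∀ a b, -lorentz (fderiv ℝ (fderiv ℝ (graphMap u)) ξ (colVec P a) (colVec P b))
      (normal u du (point ξ)) = if a = b then lam a else 0 := by
    intro a b
    have := congrFun (congrFun hH b) a
    rw [hd.secondForm_eq hM hx, pullback_apply, Matrix.diagonal_apply] at this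
    refine this.trans ?_
    by_cases hab : a = b
    · subst hab; rfl
    · rw [if_neg hab, if_neg (Ne.symm hab)]
  -- ln 𝒲 + S ln u = ln(u𝒲) + ((S - 1)/2) ln u².
  have hmax' : IsLocalMax (fun η => Real.log (-lorentz (graphMap u η) (normal u du (point η))) +
      (S - 1) / 2 * Real.log (-lorentz (graphMap u η) (graphMap u η))) ξ := by
    refine hmax.congr ?_
    filter_upwards [eventually_point_mem hM hx] with η hη
    have hsη := hs _ hη
    have e1 : lorentz (graphMap u η) (normal u du (point η)) =
        -(u (point η) * gradFun u du (point η)) :=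
      IsSpacelikeAt.lorentz_smul_normal (u := u) (du := du) (x := point η)
    have e2 : lorentz (graphMap u η) (graphMap u η) = -u (point η) ^ 2 := by
      rw [show graphMap u η = u (point η) • position η from rfl, lorentz_smul_left,
        lorentz_smul_right, lorentz_position_self]; ring
    rw [e1, e2, neg_neg, neg_neg, Real.log_mul hsη.pos.ne' hsη.gradFun_pos.ne', Real.log_pow]
    push_cast
    ring
  have hcond := hyp.conditions_of_isLocalMax hT hHT hsx.pos hsx.gradFun_pos hZ hdec hXX hmax'
  -- The Lorentzian square of the decomposition of X: -u² = ∑Z_a² - u²𝒲².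
  have hZsum : ∑ a, Z a ^ 2 = u (point ξ) ^ 2 * (gradFun u du (point ξ) ^ 2 - 1) := by
    have h1 : lorentz (fderiv ℝ (graphMap u) ξ z) (fderiv ℝ (graphMap u) ξ z) = ∑ a, Z a ^ 2 := by
      rw [hZ, map_sum, lorentz_sum_left]
      refine Finset.sum_congr rfl fun a _ => ?_
      rw [lorentz_sum_right]
      simp [lorentz_smul_left, lorentz_smul_right, hT, pow_two]
    have h2 := hyp.orthogonal.self_of_nhds z
    rw [← h1]
    have h3 : lorentz (graphMap u ξ) (graphMap u ξ) = _ :=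
      congrArg₂ lorentz (hX0.trans hdec) (hX0.trans hdec)
    rw [hXX, lorentz_add_left, lorentz_add_right, lorentz_add_right, lorentz_smul_left,
      lorentz_smul_right, lorentz_smul_left, lorentz_smul_right, hsx.lorentz_normal_self,
      lorentz_comm (normal u du (point ξ)), h2] at h3
    linear_combination -h3
  refine interior_max_algebra hlk hlam hsx.pos hW hb ((covecNorm_nonneg _ _).trans hB) hBS hWS
    (Z := Z) ?_ hZsum (fun a => (hcond a).1) (fun a => (hcond a).2) ?_
  · rw [← hw, ← hw, ← le_div_iff₀ (by rw [hw]; exact hlam l (by omega)), heq _ hx]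
    exact hbf
  · have hsl : 0 < elem lam Finset.univ l := hlam l (by omega)
    have hdk := hasDerivAt_weingarten hd hM hs hx hP hG hH z k
    have hdl := hasDerivAt_weingarten hd hM hs hx hP hG hH z l
    have hq := hdk.fun_div hdl (by simp only [zero_smul, add_zero, hw]; exact hsl.ne')
    -- Differentiability of the right-hand side is inherited from the curvatures through the
    -- equation; without it `fderiv` would be the default 0 and the bound by B would say nothing.
    have hdiff : DifferentiableAt ℝ (fun η => f (point η)) ξ := by
      have : (fun η => f (point η)) =ᶠ[𝓝 ξ] fun η =>
          weingarten u du k (point η) / weingarten u du l (point η) := by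
        filter_upwards [eventually_point_mem hM hx] with η hη using (heq _ hη).symm
      refine DifferentiableAt.congr_of_eventuallyEq ?_ this
      refine differentiableAt_div (differentiableAt_weingarten hd hM hs hx k)
        (differentiableAt_weingarten hd hM hs hx l) ?_
      rw [hw]; exact hsl.ne'
    have hline := hasDerivAt_line (f := fun η => f (point η)) (ξ := ξ) (e := z) (t := 0)
      (by rw [zero_smul, add_zero]; exact hdiff)
    have hev : (fun t : ℝ => f (point (ξ + t • z))) =ᶠ[𝓝 0] fun t =>
        weingarten u du k (point (ξ + t • z)) / weingarten u du l (point (ξ + t • z)) := by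
      filter_upwards [(tendsto_line ξ z).eventually (eventually_point_mem hM hx)] with t ht
        using (heq _ ht).symm
    have huniq := hline.unique (hq.congr_of_eventuallyEq hev)
    simp only [zero_smul, add_zero, hw] at huniq
    rw [eq_div_iff (pow_ne_zero 2 hsl.ne')] at huniq
    have habs := (le_abs_self _).trans
      (abs_apply_le (point ξ) (fderiv ℝ (fun ξ => f (point ξ)) ξ) z)
    have hzz : hypInner ξ z z = gradFun u du (point ξ) ^ 2 * (gradFun u du (point ξ) ^ 2 - 1) :=
      hsx.hypInner_direction
    rw [coord_point, hzz, Real.sqrt_mul (sq_nonneg _), Real.sqrt_sq hsx.gradFun_pos.le] at habs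
    have hfin : fderiv ℝ (fun ξ => f (point ξ)) ξ z ≤
        B * (gradFun u du (point ξ) * √(gradFun u du (point ξ) ^ 2 - 1)) :=
      habs.trans (mul_le_mul_of_nonneg_right hB
        (mul_nonneg hsx.gradFun_pos.le (Real.sqrt_nonneg _)))
    have := mul_le_mul_of_nonneg_right hfin (sq_nonneg (elem lam Finset.univ l))
    rw [huniq, mul_comm _ (elem lam Finset.univ l ^ 2)] at this
    refine le_of_eq_of_le ?_ this
    simp only [quotDeriv]
    rw [Finset.sum_mul, Finset.mul_sum, ← Finset.sum_sub_distrib]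
    exact Finset.sum_congr rfl fun a _ => by ring

end HypGraph

/-! ### Hyperbolic distance, geodesics and the oscillation of ln u -/

namespace HypGraph

open Filter Topology

variable {n : ℕ}

section Distance

theorem lorentz_coord (x y : Hyp n) : lorentz x.1 y.1 =
    inner ℝ (coord x) (coord y) - √(1 + ‖coord x‖ ^ 2) * √(1 + ‖coord y‖ ^ 2) := by
  rw [← position_coord x, ← position_coord y, lorentz_eq_inner]
  rfl

/-- The reversed Cauchy–Schwarz inequality in quantitative form: both correction terms are
nonnegative, and they vanish together only for ξ = η. -/
theorem sq_time_mul (ξ η : EuclideanSpace ℝ (Fin n)) :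
    (√(1 + ‖ξ‖ ^ 2) * √(1 + ‖η‖ ^ 2)) ^ 2 = (1 + inner ℝ ξ η) ^ 2 + ‖ξ - η‖ ^ 2 +
      (‖ξ‖ ^ 2 * ‖η‖ ^ 2 - inner ℝ ξ η ^ 2) := by
  rw [mul_pow, Real.sq_sqrt (by positivity), Real.sq_sqrt (by positivity), norm_sub_sq_real]
  ring

theorem sq_inner_le (ξ η : EuclideanSpace ℝ (Fin n)) : inner ℝ ξ η ^ 2 ≤ ‖ξ‖ ^ 2 * ‖η‖ ^ 2 := by
  have := real_inner_mul_inner_self_le ξ η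
  rw [real_inner_self_eq_norm_sq, real_inner_self_eq_norm_sq] at this
  linarith

theorem one_le_neg_lorentz (x y : Hyp n) : 1 ≤ -lorentz x.1 y.1 := by
  rw [lorentz_coord]
  have h1 := sq_time_mul (coord x) (coord y)
  have h2 := sq_inner_le (coord x) (coord y)
  have h3 : 1 + inner ℝ (coord x) (coord y) ≤
      √(1 + ‖coord x‖ ^ 2) * √(1 + ‖coord y‖ ^ 2) := by
    refine le_of_sq_le_sq ?_ (by positivity)
    nlinarith [sq_nonneg ‖coord x - coord y‖]
  linarith

theorem one_lt_neg_lorentz {x y : Hyp n} (hxy : x ≠ y) : 1 < -lorentz x.1 y.1 := by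
  refine lt_of_le_of_ne (one_le_neg_lorentz x y) fun h => hxy ?_
  rw [lorentz_coord] at h
  have h1 := sq_time_mul (coord x) (coord y)
  have h2 := sq_inner_le (coord x) (coord y)
  have h3 : √(1 + ‖coord x‖ ^ 2) * √(1 + ‖coord y‖ ^ 2) = 1 + inner ℝ (coord x) (coord y) := by
    linarith
  rw [h3] at h1
  have h4 : ‖coord x - coord y‖ = 0 := by
    have : ‖coord x - coord y‖ ^ 2 = 0 := by nlinarith [sq_nonneg ‖coord x - coord y‖]
    simpa using this
  rw [← point_coord x, ← point_coord y, sub_eq_zero.1 (norm_eq_zero.1 h4)]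

theorem continuous_lorentz_val : Continuous fun p : Hyp n × Hyp n => lorentz p.1.1 p.2.1 := by
  simp only [← lorentzL_apply]
  fun_prop

theorem continuous_hypDist : Continuous fun p : Hyp n × Hyp n => hypDist p.1 p.2 :=
  Real.continuousOn_arcosh.comp_continuous continuous_lorentz_val.neg
    fun p => one_le_neg_lorentz p.1 p.2

theorem hypDist_nonneg (x y : Hyp n) : 0 ≤ hypDist x y :=
  Real.arcosh_nonneg (one_le_neg_lorentz x y)

theorem cosh_hypDist (x y : Hyp n) : Real.cosh (hypDist x y) = -lorentz x.1 y.1 :=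
  Real.cosh_arcosh (one_le_neg_lorentz x y)

theorem hypDist_le_hypDiam {M : Set (Hyp n)} (hb : HypBounded M) {x y : Hyp n}
    (hx : x ∈ closure M) (hy : y ∈ closure M) : hypDist x y ≤ hypDiam M := by
  have hmem : (x, y) ∈ closure (M ×ˢ M) := by rw [closure_prod_eq]; exact ⟨hx, hy⟩
  have hcl : IsClosed {p : Hyp n × Hyp n | hypDist p.1 p.2 ≤ hypDiam M} :=
    isClosed_le continuous_hypDist continuous_const
  exact closure_minimal (fun p hp => le_csSup hb ⟨p.1, hp.1, p.2, hp.2, rfl⟩) hcl hmem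

theorem isCompact_closure_of_hypBounded {M : Set (Hyp n)} (hb : HypBounded M) :
    IsCompact (closure M) := by
  rcases M.eq_empty_or_nonempty with rfl | ⟨y, hy⟩
  · simp
  obtain ⟨C, hC⟩ := hb
  -- Since -⟨x, y⟩ ≥ a |ξ| for ξ the coordinates of x, bounded distance to y bounds ξ.
  set a := √(1 + ‖coord y‖ ^ 2) - ‖coord y‖ with ha
  have ha0 : 0 < a := by
    rw [ha, sub_pos]
    exact Real.lt_sqrt_of_sq_lt (by linarith)
  have hsub : M ⊆ point '' Metric.closedBall (0 : EuclideanSpace ℝ (Fin n)) (Real.cosh C / a) := by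
    intro x hx
    refine ⟨coord x, ?_, point_coord x⟩
    rw [mem_closedBall_zero_iff, le_div_iff₀ ha0]
    have h1 : hypDist x y ≤ C := hC ⟨x, hx, y, hy, rfl⟩
    have h2 : -lorentz x.1 y.1 ≤ Real.cosh C := by
      rw [← cosh_hypDist]
      refine Real.cosh_le_cosh.2 ?_
      rw [abs_of_nonneg (hypDist_nonneg x y)]
      exact h1.trans (le_abs_self C)
    rw [lorentz_coord] at h2
    have h3 : ‖coord x‖ ≤ √(1 + ‖coord x‖ ^ 2) := Real.le_sqrt_of_sq_le (by linarith)
    have h4 := real_inner_le_norm (coord x) (coord y)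
    have h5 := mul_le_mul_of_nonneg_right h3 (Real.sqrt_nonneg (1 + ‖coord y‖ ^ 2))
    rw [ha, mul_sub]
    linarith
  have hK := (isCompact_closedBall (0 : EuclideanSpace ℝ (Fin n)) (Real.cosh C / a)).image
    continuous_point
  exact hK.of_isClosed_subset isClosed_closure (closure_minimal hsub hK.isClosed)

end Distance

/-- A complete geodesic line of the hyperbolic space, parametrized by arc length. -/
structure IsUnitLine (c : ℝ → Hyp n) : Prop where
  dist : ∀ s t, hypDist (c s) (c t) = |s - t|
  deriv : ∀ t, ∃ v, HasDerivAt (fun t => (c t).1) v t ∧ lorentz v v = 1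

namespace IsUnitLine

variable {c : ℝ → Hyp n}

theorem continuous (h : IsUnitLine c) : Continuous c := by
  refine continuous_induced_rng.2 (continuous_iff_continuousAt.2 fun t => ?_)
  obtain ⟨v, hv, _⟩ := h.deriv t
  exact hv.continuousAt

theorem shift (h : IsUnitLine c) (d : ℝ) : IsUnitLine fun t => c (d + t) := by
  refine ⟨fun s t => by rw [h.dist]; congr 1; ring, fun t => ?_⟩
  obtain ⟨v, hv, h1⟩ := h.deriv (d + t)
  exact ⟨v, hv.comp_const_add d t, h1⟩

theorem reverse (h : IsUnitLine c) : IsUnitLine fun t => c (-t) := by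
  refine ⟨fun s t => by rw [h.dist, ← abs_neg]; congr 1; ring, fun t => ?_⟩
  obtain ⟨v, hv, h1⟩ := h.deriv (-t)
  refine ⟨-v, ?_, ?_⟩
  · simpa [Function.comp_def] using hv.scomp t (hasDerivAt_neg t)
  · rw [← neg_one_smul ℝ v, lorentz_smul_left, lorentz_smul_right, h1]; norm_num

end IsUnitLine

theorem exists_unitLine {x y : Hyp n} (hxy : x ≠ y) :
    ∃ c : ℝ → Hyp n, IsUnitLine c ∧ c 0 = x ∧ c (hypDist x y) = y := by
  set d := hypDist x y with hd
  have hch : Real.cosh d = -lorentz x.1 y.1 := cosh_hypDist x y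
  have hd0 : 0 < d := Real.arcosh_pos (one_lt_neg_lorentz hxy)
  have hs0 : 0 < Real.sinh d := Real.sinh_pos_iff.2 hd0
  have hcs := Real.cosh_sq d
  -- The unit tangent vector at x pointing to y; the line is cosh t · x + sinh t · b.
  set b : Mink n := (1 / Real.sinh d) • (y.1 - Real.cosh d • x.1) with hb
  have hxy' : lorentz x.1 y.1 = -Real.cosh d := by linarith
  have hxx := x.2.1
  have hyy := y.2.1
  have hsubr : ∀ V X Y : Mink n, lorentz V (X - Y) = lorentz V X - lorentz V Y := fun V X Y => by
    rw [lorentz_comm, lorentz_sub_left, lorentz_comm X, lorentz_comm Y]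
  have hxb : lorentz x.1 b = 0 := by
    rw [hb, lorentz_smul_right, hsubr, lorentz_smul_right, hxx, hxy']; ring
  have hbb : lorentz b b = 1 := by
    rw [hb, lorentz_smul_left, lorentz_smul_right, lorentz_sub_left, hsubr, hsubr,
      lorentz_smul_left, lorentz_smul_left, lorentz_smul_right, lorentz_smul_right, hxx, hyy,
      lorentz_comm y.1, hxy']
    field_simp
    linarith
  have hlor : ∀ p q r s : ℝ, lorentz (p • x.1 + q • b) (r • x.1 + s • b) = -(p * r) + q * s := by
    intro p q r s
    rw [lorentz_add_left, lorentz_add_right, lorentz_add_right]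
    simp only [lorentz_smul_left, lorentz_smul_right, hxx, hbb, hxb, lorentz_comm b x.1]
    ring
  -- This keeps the line on the upper sheet for all t. It is Cauchy–Schwarz for the space parts,
  -- whose product is x.1.2 * b.2 by orthogonality.
  have hbx : b.2 ^ 2 < x.1.2 ^ 2 := by
    have h1 := hxb
    have h2 := hbb
    have h3 := hxx
    rw [lorentz_eq_inner] at h1 h2 h3
    rw [real_inner_self_eq_norm_sq] at h2 h3
    have h4 := sq_inner_le x.1.1 b.1
    have h5 : inner ℝ x.1.1 b.1 = x.1.2 * b.2 := by linarith
    have h6 : ‖x.1.1‖ ^ 2 = x.1.2 ^ 2 - 1 := by linarith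
    have h7 : ‖b.1‖ ^ 2 = b.2 ^ 2 + 1 := by linarith
    rw [h5, h6, h7] at h4
    linarith
  have hpos : ∀ t, 0 < (Real.cosh t • x.1 + Real.sinh t • b).2 := by
    intro t
    have h1 : |Real.sinh t * b.2| < Real.cosh t * x.1.2 := by
      refine abs_lt_of_sq_lt_sq ?_ (mul_nonneg (Real.cosh_pos t).le x.2.2.le)
      rw [mul_pow, mul_pow, Real.cosh_sq]
      nlinarith [sq_nonneg (Real.sinh t), sq_pos_of_pos x.2.2]
    have := (abs_lt.1 h1).1
    change 0 < Real.cosh t * x.1.2 + Real.sinh t * b.2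
    linarith
  refine ⟨fun t => ⟨Real.cosh t • x.1 + Real.sinh t • b, ?_, hpos t⟩, ⟨?_, ?_⟩, ?_, ?_⟩
  · rw [hlor]
    have := Real.cosh_sq t
    linarith
  · intro s t
    rw [hypDist]
    simp only [hlor]
    rw [← Real.arcosh_cosh (abs_nonneg (s - t)), Real.cosh_abs, Real.cosh_sub]
    congr 1
    ring
  · intro t
    refine ⟨Real.sinh t • x.1 + Real.cosh t • b,
      ((Real.hasDerivAt_cosh t).smul_const x.1).add ((Real.hasDerivAt_sinh t).smul_const b), ?_⟩
    rw [hlor]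
    have := Real.cosh_sq t
    linarith
  · refine Subtype.ext ?_
    simp
  · refine Subtype.ext ?_
    simp only [hb, smul_smul]
    rw [mul_one_div_cancel hs0.ne', one_smul, add_sub_cancel]

section Curves

variable {M : Set (Hyp n)} {u : Hyp n → ℝ} {du : Hyp n → EuclideanSpace ℝ (Fin n) →L[ℝ] ℝ}

/-- Along a curve in `M`, the function `ln u` changes at most at the speed of the curve. -/
theorem exists_hasDerivWithinAt_log (hd : HasDifferential M u du)
    (hs : ∀ x ∈ M, IsSpacelikeAt u du x) {c : ℝ → Mink n} {v : Mink n} {s : Set ℝ} {t : ℝ}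
    (hc : HasDerivWithinAt c v s t) (hmem : ∀ r ∈ s, c r ∈ Subtype.val '' M) (ht : t ∈ s)
    (hu : UniqueDiffWithinAt ℝ s t) :
    ∃ d, HasDerivWithinAt (fun r => Real.log (u (point (c r).1))) d s t ∧
      |d| ≤ √(lorentz v v) := by
  have hpt : ∀ r ∈ s, ∃ x ∈ M, c r = x.1 ∧ point (c r).1 = x := by
    intro r hr
    obtain ⟨x, hx, hxr⟩ := hmem r hr
    exact ⟨x, hx, hxr.symm, by rw [← hxr]; exact point_coord x⟩
  obtain ⟨x, hx, hcx, hpx⟩ := hpt t ht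
  have hfst : HasDerivWithinAt (fun r => (c r).1) v.1 s t :=
    (ContinuousLinearMap.fst ℝ (EuclideanSpace ℝ (Fin n)) ℝ).hasFDerivAt.comp_hasDerivWithinAt t hc
  have hct : (c t).1 = coord x := by rw [hcx]; rfl
  have hpos : HasFDerivAt (position : EuclideanSpace ℝ (Fin n) → Mink n)
      (fderiv ℝ position (c t).1) (c t).1 :=
    (contDiff_position (m := 1)).differentiable (by simp) _ |>.hasFDerivAt
  have hv : v = fderiv ℝ position (coord x) v.1 := by
    have h1 := hpos.comp_hasDerivWithinAt t hfst
    have h2 : HasDerivWithinAt c (fderiv ℝ position (c t).1 v.1) s t := by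
      refine h1.congr (fun r hr => ?_) ?_
      · obtain ⟨y, _, hy, _⟩ := hpt r hr
        rw [Function.comp_apply, hy]
        exact (position_coord y).symm
      · rw [Function.comp_apply, hcx]
        exact (position_coord x).symm
    rw [← hct]
    exact hu.eq_deriv s hc h2
  have hU := hd.hasFDerivAt x hx
  rw [← hct] at hU
  have hsx := hs x hx
  have hlog := (hU.comp_hasDerivWithinAt t hfst).log (by
    rw [Function.comp_apply, hpx]; exact hsx.pos.ne')
  refine ⟨_, hlog, ?_⟩
  rw [Function.comp_apply, hpx, abs_div, abs_of_pos hsx.pos, div_le_iff₀ hsx.pos]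
  have h1 := abs_apply_le x (du x) v.1
  have h2 : lorentz v v = hypInner (coord x) v.1 v.1 := by
    rw [← lorentz_fderiv_position, ← hv]
  rw [h2, mul_comm]
  refine h1.trans (mul_le_mul_of_nonneg_right ?_ (Real.sqrt_nonneg _))
  exact ((div_lt_one hsx.pos).1 hsx.lt_one).le

theorem abs_log_sub_le_curveLength (hd : HasDifferential M u du)
    (hs : ∀ x ∈ M, IsSpacelikeAt u du x) {x y : Hyp n} {γ : ℝ → Mink n}
    (hγ : IsCurveIn M x y γ) :
    ENNReal.ofReal (Real.log (u y) - Real.log (u x)) ≤ curveLength γ := by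
  obtain ⟨hC, h0, h1, hmem⟩ := hγ
  have huniq := uniqueDiffOn_Icc (zero_lt_one (α := ℝ))
  have hder : ∀ t ∈ Icc (0 : ℝ) 1, HasDerivWithinAt γ (derivWithin γ (Icc 0 1) t) (Icc 0 1) t :=
    fun t ht => ((hC.differentiableOn (by simp)) t ht).hasDerivWithinAt
  have hspeed : ContinuousOn (fun t => √(lorentz (derivWithin γ (Icc 0 1) t)
      (derivWithin γ (Icc 0 1) t))) (Icc 0 1) := by
    have h2 := hC.continuousOn_derivWithin huniq le_rfl
    simp only [← lorentzL_apply]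
    fun_prop
  have hlog := fun t ht => exists_hasDerivWithinAt_log hd hs (hder t ht) hmem ht (huniq t ht)
  choose! g' hg' hb using hlog
  have hint : MeasureTheory.IntegrableOn (fun t => √(lorentz (derivWithin γ (Icc 0 1) t)
      (derivWithin γ (Icc 0 1) t))) (Icc 0 1) := hspeed.integrableOn_Icc
  have hle := intervalIntegral.sub_le_integral_of_hasDeriv_right_of_le (zero_le_one (α := ℝ))
    (fun t ht => (hg' t ht).continuousWithinAt)
    (fun t ht => ((hg' t (Ioo_subset_Icc_self ht)).hasDerivAt
      (Icc_mem_nhds ht.1 ht.2)).hasDerivWithinAt) hint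
    (fun t ht => (le_abs_self _).trans (hb t (Ioo_subset_Icc_self ht)))
  have e0 : point (γ 0).1 = x := by rw [h0]; exact point_coord x
  have e1 : point (γ 1).1 = y := by rw [h1]; exact point_coord y
  rw [e0, e1, intervalIntegral.integral_of_le zero_le_one,
    ← MeasureTheory.integral_Icc_eq_integral_Ioc] at hle
  rw [curveLength, ← MeasureTheory.ofReal_integral_eq_lintegral_ofReal hint
    (Eventually.of_forall fun t => Real.sqrt_nonneg _)]
  exact ENNReal.ofReal_le_ofReal hle

theorem log_sub_le_riemDiam (hd : HasDifferential M u du) (hpos : ∀ x ∈ closure M, 0 < u x)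
    (hs : ∀ x ∈ M, IsSpacelikeAt u du x) (hfin : riemDiam M ≠ ⊤) {x y : Hyp n}
    (hx : x ∈ closure M) (hy : y ∈ closure M) :
    Real.log (u y) - Real.log (u x) ≤ (riemDiam M).toReal := by
  have hM : ∀ p ∈ M ×ˢ M, Real.log (u p.2) - Real.log (u p.1) ≤ (riemDiam M).toReal := by
    rintro ⟨x, y⟩ ⟨hx, hy⟩
    have h1 : ENNReal.ofReal (Real.log (u y) - Real.log (u x)) ≤ riemDiam M := by
      refine le_trans ?_ (le_iSup₂_of_le x hx (le_iSup₂_of_le y hy le_rfl))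
      exact le_iInf₂ fun γ hγ => abs_log_sub_le_curveLength hd hs hγ
    exact (ENNReal.ofReal_le_iff_le_toReal hfin).1 h1
  have hlog : ContinuousOn (fun x => Real.log (u x)) (closure M) :=
    hd.continuousOn.log fun x hx => (hpos x hx).ne'
  have hcont : ContinuousOn (fun p : Hyp n × Hyp n => Real.log (u p.2) - Real.log (u p.1))
      (closure (M ×ˢ M)) := by
    rw [closure_prod_eq]
    exact (hlog.comp continuousOn_snd fun p hp => hp.2).sub
      (hlog.comp continuousOn_fst fun p hp => hp.1)
  have hmem : (x, y) ∈ closure (M ×ˢ M) := by rw [closure_prod_eq]; exact ⟨hx, hy⟩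
  exact le_on_closure hM hcont continuousOn_const hmem

/-- A geodesic line starting in the closure of `M` reaches the boundary. -/
theorem exists_exit (hd : HasDifferential M u du) (hpos : ∀ x ∈ closure M, 0 < u x)
    (hs : ∀ x ∈ M, IsSpacelikeAt u du x) (hM : IsOpen M) (hb : HypBounded M) {c : ℝ → Hyp n}
    (hc : IsUnitLine c) (h0 : c 0 ∈ closure M) :
    ∃ T, 0 ≤ T ∧ c T ∈ frontier M ∧ |Real.log (u (c T)) - Real.log (u (c 0))| ≤ T := by
  by_cases hf : c 0 ∈ M
  swap
  · exact ⟨0, le_rfl, by rw [frontier, hM.interior_eq]; exact ⟨h0, hf⟩, by simp⟩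
  set K := {t : ℝ | 0 ≤ t ∧ c t ∉ M} with hK
  have hKc : IsClosed K := isClosed_Ici.inter (hM.preimage hc.continuous).isClosed_compl
  have hKne : K.Nonempty := by
    -- The line has unit speed and minimizes distance, so past the diameter it is outside M; T below
    -- is the first exit time.
    refine ⟨hypDiam M + 1, ?_, fun hmem => ?_⟩
    · have := hypDist_le_hypDiam hb h0 h0
      linarith [hypDist_nonneg (c 0) (c 0)]
    · have h1 := hypDist_le_hypDiam hb h0 (subset_closure hmem)
      rw [hc.dist, zero_sub, abs_neg] at h1
      linarith [le_abs_self (hypDiam M + 1)]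
  have hKb : BddBelow K := ⟨0, fun t ht => ht.1⟩
  have hT := hKc.csInf_mem hKne hKb
  set T := sInf K with hTdef
  have hT0 : 0 < T := lt_of_le_of_ne hT.1 fun h => hT.2 (h ▸ hf)
  have hlt : ∀ t, 0 ≤ t → t < T → c t ∈ M := by
    intro t ht0 htT
    by_contra hcon
    exact (csInf_le hKb ⟨ht0, hcon⟩).not_gt htT
  have hle : ∀ r ∈ Ioo 0 T, |Real.log (u (c r)) - Real.log (u (c 0))| ≤ r := by
    intro r hr
    have hmem : ∀ t ∈ Icc 0 r, (c t).1 ∈ Subtype.val '' M := fun t ht =>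
      ⟨c t, hlt t ht.1 (ht.2.trans_lt hr.2), rfl⟩
    have hder : ∀ t ∈ Icc 0 r, ∃ d, HasDerivWithinAt
        (fun t => Real.log (u (point (c t).1.1))) d (Icc 0 r) t ∧ |d| ≤ 1 := by
      intro t ht
      obtain ⟨v, hv, hvv⟩ := hc.deriv t
      have := exists_hasDerivWithinAt_log hd hs (hv.hasDerivWithinAt (s := Icc 0 r)) hmem ht
        (uniqueDiffOn_Icc hr.1 t ht)
      rwa [hvv, Real.sqrt_one] at this
    choose! g' hg' hb' using hder
    have := (convex_Icc (0 : ℝ) r).norm_image_sub_le_of_norm_hasDerivWithin_le (C := 1) hg' hb'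
      (left_mem_Icc.2 hr.1.le) (right_mem_Icc.2 hr.1.le)
    have e : ∀ t, point (c t).1.1 = c t := fun t => point_coord (c t)
    simp only [e, Real.norm_eq_abs, one_mul, sub_zero, abs_of_pos hr.1] at this
    exact this
  have hcl : ∀ t ∈ Icc 0 T, c t ∈ closure M := by
    have h1 : Icc 0 T ⊆ closure (Ico 0 T) := by rw [closure_Ico hT0.ne]
    intro t ht
    refine closure_mono ?_ (image_closure_subset_closure_image hc.continuous ⟨t, h1 ht, rfl⟩)
    rintro _ ⟨r, hr, rfl⟩
    exact hlt r hr.1 hr.2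
  refine ⟨T, hT0.le, ?_, ?_⟩
  · rw [frontier, hM.interior_eq]
    exact ⟨hcl T (right_mem_Icc.2 hT0.le), hT.2⟩
  · have hcont : ContinuousOn (fun r => |Real.log (u (c r)) - Real.log (u (c 0))|)
        (closure (Ioo 0 T)) := by
      rw [closure_Ioo hT0.ne]
      have hlog : ContinuousOn (fun x => Real.log (u x)) (closure M) :=
        hd.continuousOn.log fun x hx => (hpos x hx).ne'
      exact ((hlog.comp hc.continuous.continuousOn hcl).sub continuousOn_const).abs
    refine le_on_closure hle hcont continuousOn_id ?_
    rw [closure_Ioo hT0.ne]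
    exact right_mem_Icc.2 hT0.le

/-- The oscillation of `ln u` is controlled by its boundary values and the diameter. -/
theorem log_sub_le_hypDiam (hd : HasDifferential M u du) (hpos : ∀ x ∈ closure M, 0 < u x)
    (hs : ∀ x ∈ M, IsSpacelikeAt u du x) (hM : IsOpen M) (hb : HypBounded M) {m : ℝ} (hm : 0 ≤ m)
    (hfr : ∀ y ∈ frontier M, |Real.log (u y)| ≤ m) {x y : Hyp n}
    (hx : x ∈ closure M) (hy : y ∈ closure M) :
    Real.log (u y) - Real.log (u x) ≤ 2 * m + hypDiam M := by
  by_cases hxy : x = y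
  · subst hxy
    have := (hypDist_nonneg x x).trans (hypDist_le_hypDiam hb hx hx)
    rw [sub_self]
    positivity
  obtain ⟨c, hc, hc0, hc1⟩ := exists_unitLine hxy
  set d := hypDist x y
  have hd0 : 0 ≤ d := hypDist_nonneg x y
  -- The segment from x to y may leave M; only its prolongations backward from x and forward from y
  -- are used. The exits lie at distance T₁ + d + T₂, which is at most the diameter, so T₁ + T₂ is
  -- too.
  obtain ⟨T₁, hT1, hf1, hl1⟩ := exists_exit hd hpos hs hM hb hc.reverse (by simpa [hc0] using hx)
  obtain ⟨T₂, hT2, hf2, hl2⟩ := exists_exit hd hpos hs hM hb (hc.shift d)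
    (by simpa [hc1] using hy)
  simp only [neg_zero, hc0, add_zero, hc1] at hl1 hl2
  have hdist := hypDist_le_hypDiam hb (frontier_subset_closure hf2) (frontier_subset_closure hf1)
  rw [hc.dist] at hdist
  have h1 := hfr _ hf1
  have h2 := hfr _ hf2
  have h3 := (le_abs_self _).trans hdist
  have := (abs_le.1 hl1).2
  have := (abs_le.1 hl2).1
  have := (abs_le.1 h1).1
  have := (abs_le.1 h2).2
  linarith

end Curves

end HypGraph

/-! ### From interior maxima to the global gradient bound -/

namespace HypGraph

open Filter Topology

variable {n : ℕ} {M : Set (Hyp n)} {u : Hyp n → ℝ} {du : Hyp n → EuclideanSpace ℝ (Fin n) →L[ℝ] ℝ}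

theorem HasDifferential.continuousOn_covecNorm (hd : HasDifferential M u du) :
    ContinuousOn (fun x => covecNorm x (du x)) (closure M) := by
  have h1 : ContinuousOn (fun x => dualVec (du x)) (closure M) :=
    (contDiff_dualVec (m := 0)).continuous.comp_continuousOn hd.continuousOn_differential
  have h2 : ContinuousOn (coord : Hyp n → EuclideanSpace ℝ (Fin n)) (closure M) :=
    continuous_coord.continuousOn
  simp only [covecNorm_eq]
  exact ((h1.norm.pow 2).add ((h2.inner h1).pow 2)).sqrt

theorem HasDifferential.continuousOn_gradFun (hd : HasDifferential M u du)
    (hs : ∀ x ∈ closure M, IsSpacelikeAt u du x) : ContinuousOn (gradFun u du) (closure M) := by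
  have h1 : ContinuousOn (tilt u du) (closure M) :=
    (continuousOn_const.sub ((hd.continuousOn_covecNorm.div hd.continuousOn
      fun x hx => (hs x hx).pos.ne').pow 2)).sqrt
  exact continuousOn_const.div h1 fun x hx => (Real.sqrt_pos.2 (hs x hx).one_sub_pos).ne'

theorem IsSpacelikeAt.gradientBound_of_le {x : Hyp n} (h : IsSpacelikeAt u du x) {K : ℝ}
    (hK : gradFun u du x ≤ K) : covecNorm x (du x) ≤ u x * √(1 - 1 / K ^ 2) := by
  have hW := h.gradFun_pos
  have hK0 : 0 < K := hW.trans_le hK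
  have h1 := h.gradFun_sq_mul
  rw [mul_comm, ← div_le_iff₀ h.pos]
  refine Real.le_sqrt_of_sq_le ?_
  have h2 : 1 / K ^ 2 ≤ 1 / gradFun u du x ^ 2 := by gcongr
  have h3 : 1 / gradFun u du x ^ 2 = 1 - (covecNorm x (du x) / u x) ^ 2 := by
    rw [div_eq_iff (by positivity)]; linarith
  linarith

/-- If `ln 𝒲 + S ln u` can only have interior maxima with `𝒲 = 1`, then `𝒲` is bounded by its
boundary values and the oscillation of `ln u`. -/
theorem gradientBound_of_osc (hd : HasDifferential M u du) (hM : IsOpen M) (hne : M.Nonempty)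
    (hcpt : IsCompact (closure M)) (hs : ∀ x ∈ closure M, IsSpacelikeAt u du x)
    (hfr : (frontier M).Nonempty) {S D : ℝ} (hS : 0 ≤ S)
    (hint : ∀ x ∈ M, IsLocalMax (fun ξ => Real.log (gradFun u du (point ξ)) +
      S * Real.log (u (point ξ))) (coord x) → gradFun u du x ≤ 1)
    (hosc : ∀ x ∈ closure M, ∀ y ∈ closure M, Real.log (u y) - Real.log (u x) ≤ D) :
    GradientBound u du M (boundarySup u du M * Real.exp (S * D)) := by
  have hW := hd.continuousOn_gradFun hs
  have hbdd : BddAbove (gradFun u du '' frontier M) :=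
    ((hcpt.of_isClosed_subset isClosed_frontier frontier_subset_closure).image_of_continuousOn
      (hW.mono frontier_subset_closure)).bddAbove
  have hle : ∀ y ∈ frontier M, gradFun u du y ≤ boundarySup u du M := fun y hy =>
    le_csSup hbdd ⟨y, hy, rfl⟩
  -- As 𝒲 ≥ 1 on a nonempty boundary, the interior alternative 𝒲 ≤ 1 is covered by the boundary
  -- supremum.
  have hone : 1 ≤ boundarySup u du M := by
    obtain ⟨y, hy⟩ := hfr
    exact (hs y (frontier_subset_closure hy)).one_le_gradFun.trans (hle y hy)
  have hΦ : ContinuousOn (fun x => Real.log (gradFun u du x) + S * Real.log (u x)) (closure M) :=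
    (hW.log fun x hx => (hs x hx).gradFun_pos.ne').add
      (continuousOn_const.mul (hd.continuousOn.log fun x hx => (hs x hx).pos.ne'))
  obtain ⟨x₀, hx₀, hmax⟩ := hcpt.exists_isMaxOn (hne.mono subset_closure) hΦ
  have hx₀W : gradFun u du x₀ ≤ boundarySup u du M := by
    by_cases hin : x₀ ∈ M
    · refine (hint x₀ hin ?_).trans hone
      have hnear : ∀ᶠ ξ in 𝓝 (coord x₀), point ξ ∈ M :=
        eventually_point_mem hM (by rwa [point_coord])
      filter_upwards [hnear] with ξ hξ
      rw [point_coord]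
      exact hmax (subset_closure hξ)
    · exact hle _ (by rw [frontier, hM.interior_eq]; exact ⟨hx₀, hin⟩)
  have hfinal : ∀ x ∈ closure M, gradFun u du x ≤ boundarySup u du M * Real.exp (S * D) := by
    intro x hx
    have h1 : Real.log (gradFun u du x) + S * Real.log (u x) ≤
        Real.log (gradFun u du x₀) + S * Real.log (u x₀) := hmax hx
    have h2 := mul_le_mul_of_nonneg_left (hosc x hx x₀ hx₀) hS
    have h3 := Real.log_le_log (hs x₀ hx₀).gradFun_pos hx₀W
    rw [← Real.log_le_log_iff (hs x hx).gradFun_pos (by positivity),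
      Real.log_mul (by positivity) (Real.exp_pos _).ne', Real.log_exp]
    linarith
  exact fun x hx => ⟨hfinal x hx, (hs x hx).gradientBound_of_le (hfinal x hx)⟩

/-- Otherwise M is clopen in a space homeomorphic to ℝⁿ, hence everything, and ℝⁿ would be compact.
-/
theorem frontier_nonempty (hn : 0 < n) (hne : M.Nonempty) (hb : HypBounded M) :
    (frontier M).Nonempty := by
  by_contra hcon
  rw [not_nonempty_iff_eq_empty, ← isClopen_iff_frontier_eq_empty] at hcon
  have hsurj : Function.Surjective (point (n := n)) := fun x => ⟨coord x, point_coord x⟩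
  have huniv : M = univ := by
    have h1 := (hcon.preimage continuous_point).eq_univ (hne.preimage hsurj)
    rw [← image_preimage_eq M hsurj, h1, image_univ_of_surjective hsurj]
  have hcpt := (isCompact_closure_of_hypBounded hb).image continuous_coord
  have hcoord : Function.Surjective (coord (n := n)) := fun ξ => ⟨point ξ, rfl⟩
  rw [huniv, closure_univ, image_univ_of_surjective hcoord] at hcpt
  have : Nonempty (Fin n) := ⟨⟨0, hn⟩⟩
  have : NoncompactSpace (EuclideanSpace ℝ (Fin n)) :=
    NormedSpace.noncompactSpace ℝ (EuclideanSpace ℝ (Fin n))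
  exact noncompact_univ _ hcpt

end HypGraph

open HypGraph in
theorem mainTheorem4 (n k l : ℕ) (hk : 2 ≤ k) (hkn : k ≤ n) (hl : l + 2 ≤ k) :
    ∃ m : ℝ, 1 < m ∧
      ∀ (M : Set (HypGraph.Hyp n)), IsOpen M → IsConnected M → HypGraph.HypBounded M →
      ∀ (ψ : HypGraph.Hyp n → ℝ → ℝ → ℝ) (φ u : HypGraph.Hyp n → ℝ)
        (du : HypGraph.Hyp n → EuclideanSpace ℝ (Fin n) →L[ℝ] ℝ) (ρ : ℝ),
      HypGraph.IsAdmissibleSolution u du k l M ψ φ ρ →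
      ∀ b B : ℝ, 0 < b → (∀ x ∈ M, b ≤ HypGraph.rhs u du ψ x) →
        (∀ x ∈ M, HypGraph.covecNorm x (HypGraph.rhsDifferential u du ψ x) ≤ B) →
      ∀ S₁ S₂ : ℝ, 1 < S₁ → ρ ^ 2 ≤ 1 - m * (S₁ + 1) / (S₁ * (S₁ - 1)) →
        max (B / (((k : ℝ) - (l : ℝ)) * b)) S₁ < S₂ →
      (HypGraph.riemDiam M ≠ ⊤ →
        HypGraph.GradientBound u du M
          (HypGraph.boundarySup u du M *
            Real.exp (S₂ * (2 * sSup ((fun x => |φ x|) '' frontier M) +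
              (HypGraph.riemDiam M).toReal)))) ∧
      HypGraph.GradientBound u du M
        (HypGraph.boundarySup u du M *
          Real.exp (S₂ * (2 * sSup ((fun x => |Real.log (φ x)|) '' frontier M) +
            HypGraph.hypDiam M))) := by
  -- The constant required by `interior_max_algebra`.
  refine ⟨4 + 2 * ((k + 1) * n), by have : (0 : ℝ) ≤ (k + 1) * n := by positivity
                                    linarith, ?_⟩
  intro M hM hconn hb ψ φ u du ρ hsol b B hb0 hbψ hBψ S₁ S₂ hS1 hρ hS2
  have hd := hsol.differential
  have hne := hconn.nonempty
  have hle : ∀ x ∈ closure M, covecNorm x (du x) / u x ≤ ρ := by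
    intro x hx
    exact le_on_closure (f := fun x => covecNorm x (du x) / u x) (g := fun _ => ρ) hsol.spacelike
      (hd.continuousOn_covecNorm.div hd.continuousOn fun x hx => (hsol.pos x hx).ne')
      continuousOn_const hx
  have hs : ∀ x ∈ closure M, IsSpacelikeAt u du x := fun x hx =>
    ⟨hsol.pos x hx, (hle x hx).trans_lt hsol.rho_lt_one⟩
  have hsM : ∀ x ∈ M, IsSpacelikeAt u du x := fun x hx => hs x (subset_closure hx)
  have hcpt := isCompact_closure_of_hypBounded hb
  have hfr := frontier_nonempty (by omega) hne hb
  have hS12 : S₁ < S₂ := (le_max_right _ _).trans_lt hS2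
  have hkl : (0 : ℝ) < k - l := by
    have : (l : ℝ) < k := by exact_mod_cast (by omega : l < k)
    linarith
  have hBS : B < S₂ * ((k - l) * b) :=
    (div_lt_iff₀ (mul_pos hkl hb0)).1 ((le_max_left _ _).trans_lt hS2)
  have hWS : ∀ x ∈ M, gradFun u du x ^ 2 * (4 + 2 * ((k + 1) * n)) ≤ S₂ - 1 := by
    intro x hx
    have hsx := hsM x hx
    have h1 := hsx.gradFun_sq_mul
    have h0 : 0 ≤ covecNorm x (du x) / u x := div_nonneg (covecNorm_nonneg _ _) hsx.pos.le
    have h2 : (covecNorm x (du x) / u x) ^ 2 ≤ ρ ^ 2 :=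
      pow_le_pow_left₀ h0 (hle x (subset_closure hx)) 2
    have hm0 : (0 : ℝ) ≤ 4 + 2 * ((k + 1) * n) := by positivity
    generalize (4 + 2 * ((k + 1) * n) : ℝ) = m at *
    have hS0 : 0 < S₁ * (S₁ - 1) := mul_pos (by linarith) (by linarith)
    have h3 : m * (S₁ + 1) / (S₁ * (S₁ - 1)) ≤ 1 - (covecNorm x (du x) / u x) ^ 2 := by linarith
    have h4 := mul_le_mul_of_nonneg_left h3 (sq_nonneg (gradFun u du x))
    rw [h1, ← mul_div_assoc, div_le_one hS0] at h4
    -- From 𝒲⁻² ≥ 1 - ρ² one has 𝒲²m ≤ S₁(S₁ - 1)/(S₁ + 1), and S₁ ≤ S₁ + 1 gives the bound S₁ - 1.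
    have h5 : gradFun u du x ^ 2 * m * (S₁ + 1) ≤ (S₁ - 1) * (S₁ + 1) := by nlinarith
    have h6 := le_of_mul_le_mul_right h5 (by linarith)
    linarith
  have hint : ∀ x ∈ M, IsLocalMax (fun ξ => Real.log (gradFun u du (point ξ)) +
      S₂ * Real.log (u (point ξ))) (coord x) → gradFun u du x ≤ 1 := fun x hx hmax =>
    gradFun_le_one_of_isLocalMax hl hd hM hsM hsol.admissible hsol.equation hx hb0 (hbψ x hx)
      (hBψ x hx) hBS (hWS x hx) hmax
  have hS0 : 0 ≤ S₂ := by linarith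
  refine ⟨fun hfin => ?_, ?_⟩
  · refine gradientBound_of_osc hd hM hne hcpt hs hfr hS0 hint fun x hx y hy => ?_
    have h1 := log_sub_le_riemDiam hd hsol.pos hsM hfin hx hy
    -- The intrinsic diameter alone bounds the oscillation, so the term with φ only has to be
    -- nonnegative.
    have h2 : 0 ≤ sSup ((fun x => |φ x|) '' frontier M) :=
      Real.sSup_nonneg (by rintro _ ⟨z, _, rfl⟩; exact abs_nonneg _)
    linarith
  · refine gradientBound_of_osc hd hM hne hcpt hs hfr hS0 hint fun x hx y hy => ?_
    have hlogc : ContinuousOn (fun x => |Real.log (u x)|) (frontier M) :=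
      ((hd.continuousOn.log fun x hx => (hsol.pos x hx).ne').abs).mono frontier_subset_closure
    have himg : (fun x => |Real.log (φ x)|) '' frontier M =
        (fun x => |Real.log (u x)|) '' frontier M :=
      image_congr fun z hz => by rw [hsol.boundary z hz]
    have hbdd : BddAbove ((fun x => |Real.log (u x)|) '' frontier M) :=
      ((hcpt.of_isClosed_subset isClosed_frontier
        frontier_subset_closure).image_of_continuousOn hlogc).bddAbove
    rw [himg]
    exact log_sub_le_hypDiam hd hsol.pos hsM hM hb
      (Real.sSup_nonneg (by rintro _ ⟨z, _, rfl⟩; exact abs_nonneg _))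
      (fun z hz => le_csSup hbdd ⟨z, hz, rfl⟩) hx hy
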